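/- Let $(V,\Omega)$ be a finite-dimensional real symplectic vector space, $\hbar>0$, and let $j$ be a positive compatible complex structure: a real-linear map with $j^2=-1$, $\Omega(jv,jw)=\Omega(v,w)$ and $\Omega(v,jv)>0$ for $v\neq 0$. Regard $V$ as a complex vector space through $j$, of complex dimension $n$, with the Hermitian inner product $\langle v,w\rangle_j=\Omega(v,jw)-i\,\Omega(v,w)$ and $|v|_j^2=\langle v,v\rangle_j$. Let $\mathcal H$ be the space of holomorphic functions $f$ on $V$ with $$\|f\|^2=(2\pi\hbar)^{-n}\int_V|f(z)|^2e^{-|z|_j^2/2\hbar}\,dz<\infty$$ ($dz$ the Lebesgue measure normalised by $|\cdot|_j$), with the corresponding inner product. The Heisenberg group $H=V\times\mathbb R$, with product $(v_1,t_1)(v_2,t_2)=(v_1+v_2,\,t_1+t_2-\tfrac12\Omega(v_1,v_2))$, acts on $\mathcal H$ by $$(U_j(v,t)f)(z)=e^{-it/\hbar+\langle z,v\rangle_j/2\hbar-|v|_j^2/4\hbar}f(z-v).$$ Let $Mp^c(V,\Omega,j)$ be the group, with componentwise multiplication, of pairs $(U,g)$ with $U$ unitary on $\mathcal H$, $g\in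 Sp(V,\Omega)$ and $U_j(gv,t)=U\,U_j(v,t)\,U^{-1}$ for all $(v,t)\in H$. For $g\in Sp(V,\Omega)$ put $C_g=\frac12(g-jgj)$ and $D_g=\frac12(g+jgj)$; then $C_g$ is invertible, and we put $Z_g=C_g^{-1}D_g$. With $e_v(z)=e^{\langle z,v\rangle_j/2\hbar}$, we say that $(U,g)\in Mp^c(V,\Omega,j)$ has parameters $(g,\lambda)$, where $\lambda\in\mathbb C$, if $|\lambda^2\det C_g|=1$ and, for all $z,v\in V$, $$(Ue_v)(z)=\lambda\exp\tfrac1{4\hbar}\{2\langle C_g^{-1}z,v\rangle_j-\langle z,Z_{g^{-1}}z\rangle_j-\langle Z_gv,v\rangle_j\}.$$ Here $\det$ is the complex determinant. Let $GL(V,j)_+$ be the set of invertible complex-linear maps $A$ of $V$ with $A+A^*$ positive definite (adjoint with respect to $\langle\cdot,\cdot\rangle_j$). Then there is a unique holomorphic function $a:GL(V,j)_+\to\mathbb C$ with $\det A=e^{a(A)}$ for all $A\in GL(V,j)_+$ and $a(1)=0$; every element of $Mp^c(V,\Omega,j)$ has unique parameters; and if $(U_1,g_1)$ and $(U_2,g_2)$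 in $Mp^c(V,\Omega,j)$ have parameters $(g_1,\lambda_1)$ and $(g_2,\lambda_2)$, then $1-Z_{g_1}Z_{g_2^{-1}}\in GL(V,j)_+$ and the product $(U_1U_2,g_1g_2)$ has parameters $(g_1g_2,\lambda_{12})$ with $$\lambda_{12}=\lambda_1\lambda_2\,e^{-\frac12a\left(1-Z_{g_1}Z_{g_2^{-1}}\right)}.$$ -/

import Mathlib

open MeasureTheory

namespace SymplecticMpc

noncomputable section

/-! ### Symplectic vector spaces and positive compatible complex structures -/

/-- A symplectic form on a real vector space: an alternating nondegenerate bilinear form. -/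
structure SymplecticForm (V : Type*) [AddCommGroup V] [Module ℝ V] where
  form : LinearMap.BilinForm ℝ V
  alt : form.IsAlt
  nondegenerate : form.Nondegenerate

/-- The symplectic group `Sp(V,Ω)`. -/
def Sp {V : Type*} [AddCommGroup V] [Module ℝ V] (Ω : SymplecticForm V) :
    Subgroup (V ≃ₗ[ℝ] V) where
  carrier := {g | ∀ v w, Ω.form (g v) (g w) = Ω.form v w}
  mul_mem' := by
    intro a b ha hb v w
    exact (ha (b v) (b w)).trans (hb v w)
  one_mem' := by intro v w; rfl
  inv_mem' := by
    intro a ha v w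
    have h := ha (a⁻¹ v) (a⁻¹ w)
    simpa [← LinearEquiv.mul_apply] using h.symm

/-- A positive compatible complex structure on `(V,Ω)`. -/
structure PCCS {V : Type*} [AddCommGroup V] [Module ℝ V] (Ω : SymplecticForm V) where
  j : V →ₗ[ℝ] V
  symplectic : ∀ v w, Ω.form (j v) (j w) = Ω.form v w
  sq : ∀ v, j (j v) = -v
  pos : ∀ v, v ≠ 0 → 0 < Ω.form v (j v)

variable {V : Type*} [AddCommGroup V] [Module ℝ V] {Ω : SymplecticForm V}

theorem SymplecticForm.swap (Ω : SymplecticForm V) (v w : V) :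
    Ω.form v w = -Ω.form w v := by
  rw [← LinearMap.BilinForm.IsAlt.neg_eq Ω.alt w v]

theorem PCCS.form_j_symm (J : PCCS Ω) (v w : V) : Ω.form v (J.j w) = Ω.form w (J.j v) := by
  have h := J.symplectic v (J.j w)
  rw [J.sq, map_neg] at h
  rw [← h, Ω.swap (J.j v) w, neg_neg]

theorem PCCS.form_j_left (J : PCCS Ω) (v w : V) : Ω.form (J.j v) w = -Ω.form v (J.j w) := by
  rw [Ω.swap, J.form_j_symm]

/-- The complex Hilbert space `(V,Ω,j)`: a copy of `V`, given below the complex scalar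
multiplication `(x+iy)v = xv + y j(v)` and the Hermitian structure `⟨v,w⟩_j`. -/
def JSpace (_J : PCCS Ω) : Type _ := V

instance (J : PCCS Ω) : AddCommGroup (JSpace J) := inferInstanceAs (AddCommGroup V)

/-- The identity map `V → (V,Ω,j)`. -/
def toJ (J : PCCS Ω) : V ≃+ JSpace J := AddEquiv.refl V

instance (J : PCCS Ω) : SMul ℂ (JSpace J) where
  smul c z := toJ J (c.re • (toJ J).symm z + c.im • J.j ((toJ J).symm z))

theorem smul_toJ (J : PCCS Ω) (c : ℂ) (v : V) :
    c • toJ J v = toJ J (c.re • v + c.im • J.j v) := rfl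

instance (J : PCCS Ω) : Module ℂ (JSpace J) where
  one_smul z := by
    obtain ⟨v, rfl⟩ := (toJ J).surjective z
    simp [smul_toJ]
  mul_smul a b z := by
    obtain ⟨v, rfl⟩ := (toJ J).surjective z
    rw [smul_toJ, smul_toJ, smul_toJ]
    congr 1
    simp only [Complex.mul_re, Complex.mul_im, map_add, map_smul, J.sq]
    module
  smul_zero a := by
    rw [← map_zero (toJ J), smul_toJ]
    simp
  smul_add a x y := by
    obtain ⟨v, rfl⟩ := (toJ J).surjective x
    obtain ⟨w, rfl⟩ := (toJ J).surjective y
    rw [← map_add]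
    simp only [smul_toJ]
    rw [← map_add]
    congr 1
    simp only [map_add]
    module
  add_smul a b x := by
    obtain ⟨v, rfl⟩ := (toJ J).surjective x
    simp only [smul_toJ, Complex.add_re, Complex.add_im]
    rw [← map_add]
    congr 1
    module
  zero_smul x := by
    obtain ⟨v, rfl⟩ := (toJ J).surjective x
    simp [smul_toJ]

/-- The Hermitian structure `⟨v,w⟩_j = Ω(v,jw) - iΩ(v,w)`, linear in `v` and antilinear
in `w`. -/
def herm (J : PCCS Ω) (v w : JSpace J) : ℂ :=
  (Ω.form ((toJ J).symm v) (J.j ((toJ J).symm w)) : ℂ)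
    - Complex.I * (Ω.form ((toJ J).symm v) ((toJ J).symm w) : ℂ)

/-- Mathlib's inner product is antilinear in the first variable, so it is
`inner ℂ v w = ⟨w,v⟩_j`. -/
@[reducible]
def hermCore (J : PCCS Ω) : InnerProductSpace.Core ℂ (JSpace J) where
  inner v w := herm J w v
  conj_inner_symm x y := by
    apply Complex.ext
    · simp only [herm, Complex.conj_re, Complex.sub_re, Complex.mul_re, Complex.I_re,
        Complex.I_im, Complex.ofReal_re, Complex.ofReal_im]
      rw [J.form_j_symm]; ring
    · simp only [herm, Complex.conj_im, Complex.sub_im, Complex.mul_im, Complex.I_re,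
        Complex.I_im, Complex.ofReal_re, Complex.ofReal_im]
      rw [Ω.swap]; ring
  re_inner_nonneg x := by
    by_cases hx : (toJ J).symm x = 0
    · simp [herm, hx]
    · have := J.pos _ hx
      simp only [herm, RCLike.re_to_complex, Complex.sub_re, Complex.mul_re, Complex.I_re,
        Complex.I_im, Complex.ofReal_re, Complex.ofReal_im]
      linarith
  add_left x y z := by
    simp only [herm, map_add]
    push_cast
    ring
  smul_left x y c := by
    obtain ⟨x, rfl⟩ := (toJ J).surjective x
    rw [smul_toJ]
    apply Complex.ext
    · simp only [herm, AddEquiv.symm_apply_apply, map_add, map_smul, J.sq, map_neg]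
      simp
      ring
    · simp only [herm, AddEquiv.symm_apply_apply, map_add, map_smul, J.sq, map_neg]
      simp
      ring
  definite x h := by
    by_contra hx
    have hx' : (toJ J).symm x ≠ 0 := by simpa using hx
    have h1 := J.pos _ hx'
    have h2 := congrArg Complex.re h
    simp only [herm, Complex.sub_re, Complex.mul_re, Complex.I_re, Complex.zero_re,
        Complex.I_im, Complex.ofReal_re, Complex.ofReal_im] at h2
    linarith

instance (J : PCCS Ω) : NormedAddCommGroup (JSpace J) :=
  @InnerProductSpace.Core.toNormedAddCommGroup ℂ (JSpace J) _ _ _ (hermCore J)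

instance (J : PCCS Ω) : InnerProductSpace ℂ (JSpace J) :=
  InnerProductSpace.ofCore (hermCore J).toCore

theorem inner_eq_herm (J : PCCS Ω) (v w : JSpace J) : inner ℂ v w = herm J w v := rfl

instance (J : PCCS Ω) : InnerProductSpace ℝ (JSpace J) := InnerProductSpace.complexToReal

theorem real_smul_toJ (J : PCCS Ω) (r : ℝ) (v : V) : r • toJ J v = toJ J (r • v) := by
  have h : r • toJ J v = toJ J ((r : ℂ).re • v + (r : ℂ).im • J.j v) := rfl
  rw [h]
  simp

/-! ### The Heisenberg group and its Fock representation -/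

/-- The Heisenberg group `V × ℝ`. -/
@[ext]
structure Heisenberg (Ω : SymplecticForm V) where
  v : V
  t : ℝ

namespace Heisenberg

instance : Mul (Heisenberg Ω) where
  mul x y := ⟨x.v + y.v, x.t + y.t - (1 / 2) * Ω.form x.v y.v⟩

instance : One (Heisenberg Ω) := ⟨⟨0, 0⟩⟩

instance : Inv (Heisenberg Ω) := ⟨fun x => ⟨-x.v, -x.t⟩⟩

theorem mul_def (x y : Heisenberg Ω) :
    x * y = ⟨x.v + y.v, x.t + y.t - (1 / 2) * Ω.form x.v y.v⟩ := rfl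

theorem one_def : (1 : Heisenberg Ω) = ⟨0, 0⟩ := rfl

theorem inv_def (x : Heisenberg Ω) : x⁻¹ = ⟨-x.v, -x.t⟩ := rfl

instance : Group (Heisenberg Ω) :=
  Group.ofLeftAxioms
    (by
      intro x y z
      ext
      · simp [mul_def, add_assoc]
      · simp [mul_def]; ring)
    (by intro x; ext <;> simp [mul_def, one_def])
    (by
      intro x
      have h : Ω.form x.v x.v = 0 := Ω.alt x.v
      ext <;> simp [mul_def, one_def, inv_def, h])

end Heisenberg

/-- The action `g·(v,t) = (g v, t)` of `Sp(V,Ω)` on the Heisenberg group. -/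
def spAct (g : Sp Ω) (x : Heisenberg Ω) : Heisenberg Ω := ⟨(g : V ≃ₗ[ℝ] V) x.v, x.t⟩

/-- The weight `exp(-|z|²/2ħ)`. -/
def fockWeight (J : PCCS Ω) (ħ : ℝ) (z : JSpace J) : ℝ := Real.exp (-‖z‖ ^ 2 / (2 * ħ))

theorem fockWeight_pos (J : PCCS Ω) (ħ : ℝ) (z : JSpace J) : 0 < fockWeight J ħ z :=
  Real.exp_pos _

theorem fockWeight_continuous (J : PCCS Ω) (ħ : ℝ) : Continuous (fockWeight J ħ) := by
  unfold fockWeight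
  fun_prop

variable [FiniteDimensional ℝ V]

instance (J : PCCS Ω) : FiniteDimensional ℝ (JSpace J) :=
  LinearEquiv.finiteDimensional
    { toJ J with map_smul' := fun r v => (real_smul_toJ J r v).symm : V ≃ₗ[ℝ] JSpace J }

instance (J : PCCS Ω) : FiniteDimensional ℂ (JSpace J) :=
  FiniteDimensional.right ℝ ℂ (JSpace J)

instance (J : PCCS Ω) : CompleteSpace (JSpace J) := FiniteDimensional.complete ℂ (JSpace J)

/-- `volume` on `JSpace J` is Lebesgue measure normalised by the norm `|·|_j`. -/
instance (J : PCCS Ω) : MeasurableSpace (JSpace J) := borel _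

instance (J : PCCS Ω) : BorelSpace (JSpace J) := ⟨rfl⟩

/-- Holomorphic functions `f` on `(V,Ω,j)` for which `∫ |f(z)|² exp(-|z|²/2ħ) dz` is finite. -/
def fockSubmodule (J : PCCS Ω) (ħ : ℝ) : Submodule ℂ (JSpace J → ℂ) where
  carrier := {f | Differentiable ℂ f ∧
    Integrable (fun z => ‖f z‖ ^ 2 * fockWeight J ħ z) volume}
  zero_mem' := by
    refine ⟨differentiable_const 0, ?_⟩
    simp
  add_mem' := by
    rintro f g ⟨hf, hf'⟩ ⟨hg, hg'⟩
    refine ⟨hf.add hg, ((hf'.add hg').const_mul 2).mono' ?_ ?_⟩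
    · exact (((hf.add hg).continuous.norm.pow 2).mul
        (fockWeight_continuous J ħ)).aestronglyMeasurable
    · refine Filter.Eventually.of_forall fun z => ?_
      have hw := fockWeight_pos J ħ z
      rw [Real.norm_of_nonneg (by positivity)]
      simp only [Pi.add_apply]
      have h1 : ‖f z + g z‖ ^ 2 ≤ 2 * (‖f z‖ ^ 2 + ‖g z‖ ^ 2) := by
        have := norm_add_le (f z) (g z)
        nlinarith [sq_nonneg (‖f z‖ - ‖g z‖), norm_nonneg (f z + g z)]
      nlinarith
  smul_mem' := by
    rintro c f ⟨hf, hf'⟩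
    refine ⟨hf.const_smul c, ?_⟩
    refine (hf'.const_mul (‖c‖ ^ 2)).congr (Filter.Eventually.of_forall fun z => ?_)
    simp only [Pi.smul_apply, smul_eq_mul, norm_mul]
    ring

/-- The Fock space `H(V,Ω,j)` with parameter `ħ`. -/
def FockSpace (J : PCCS Ω) (ħ : ℝ) : Type _ := fockSubmodule J ħ

instance (J : PCCS Ω) (ħ : ℝ) : AddCommGroup (FockSpace J ħ) :=
  inferInstanceAs (AddCommGroup (fockSubmodule J ħ))

instance (J : PCCS Ω) (ħ : ℝ) : Module ℂ (FockSpace J ħ) :=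
  inferInstanceAs (Module ℂ (fockSubmodule J ħ))

instance (J : PCCS Ω) (ħ : ℝ) : CoeFun (FockSpace J ħ) (fun _ => JSpace J → ℂ) :=
  ⟨fun f => f.1⟩

namespace FockSpace

variable {J : PCCS Ω} {ħ : ℝ}

theorem ext {f g : FockSpace J ħ} (h : ∀ z, f z = g z) : f = g := Subtype.ext (funext h)

theorem add_apply (f g : FockSpace J ħ) (z : JSpace J) : (f + g) z = f z + g z := rfl

theorem smul_apply (c : ℂ) (f : FockSpace J ħ) (z : JSpace J) : (c • f) z = c * f z := rfl

theorem continuous (f : FockSpace J ħ) : Continuous f := f.2.1.continuous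

theorem integrable_mul (f g : FockSpace J ħ) :
    Integrable (fun z => starRingEnd ℂ (f z) * g z * (fockWeight J ħ z : ℂ)) volume := by
  refine ((f.2.2.add g.2.2)).mono' ?_ ?_
  · exact ((((Complex.continuous_conj.comp f.continuous).mul g.continuous)).mul
      (Complex.continuous_ofReal.comp (fockWeight_continuous J ħ))).aestronglyMeasurable
  · refine Filter.Eventually.of_forall fun z => ?_
    have hw := fockWeight_pos J ħ z
    simp only [Pi.add_apply, norm_mul, RCLike.norm_conj, Complex.norm_real,
      Real.norm_of_nonneg hw.le]
    have h1 : ‖f z‖ * ‖g z‖ ≤ ‖f z‖ ^ 2 + ‖g z‖ ^ 2 := by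
      nlinarith [sq_nonneg (‖f z‖ - ‖g z‖), norm_nonneg (f z), norm_nonneg (g z)]
    nlinarith

/-- The inner product `(f₁,f₂)_j = h⁻ⁿ ∫ f₁ conj(f₂) exp(-|z|²/2ħ) dz` with `h = 2πħ` and
`n = dim_ℂ (V,Ω,j)`. -/
def pairing (f₁ f₂ : FockSpace J ħ) : ℂ :=
  (((2 * Real.pi * ħ) ^ Module.finrank ℂ (JSpace J))⁻¹ : ℝ) *
    ∫ z, starRingEnd ℂ (f₂ z) * f₁ z * (fockWeight J ħ z : ℂ)

theorem pairing_self (f : FockSpace J ħ) : pairing f f =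
    ((((2 * Real.pi * ħ) ^ Module.finrank ℂ (JSpace J))⁻¹ *
      ∫ z, ‖f z‖ ^ 2 * fockWeight J ħ z : ℝ) : ℂ) := by
  have h : ∀ z, starRingEnd ℂ (f z) * f z * (fockWeight J ħ z : ℂ)
      = ((‖f z‖ ^ 2 * fockWeight J ħ z : ℝ) : ℂ) := by
    intro z
    rw [Complex.conj_mul']
    push_cast
    rfl
  simp only [pairing, h]
  rw [integral_complex_ofReal]
  push_cast
  rfl

variable [hħ : Fact (0 < ħ)]

/-- As before, Mathlib's inner product is antilinear in the first variable, so that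
`inner ℂ f g = (g,f)_j`. -/
@[reducible]
def core (J : PCCS Ω) (ħ : ℝ) [hħ : Fact (0 < ħ)] :
    InnerProductSpace.Core ℂ (FockSpace J ħ) where
  inner f g := pairing g f
  conj_inner_symm f g := by
    simp only [pairing, map_mul, Complex.conj_ofReal]
    rw [← integral_conj]
    congr 2
    funext z
    simp only [map_mul, Complex.conj_conj, Complex.conj_ofReal]
    ring
  re_inner_nonneg f := by
    rw [pairing_self, RCLike.re_to_complex, Complex.ofReal_re]
    have := hħ.out
    refine mul_nonneg (by positivity) (integral_nonneg fun z => ?_)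
    have := fockWeight_pos J ħ z
    positivity
  add_left f g k := by
    simp only [pairing]
    rw [← mul_add, ← integral_add (integrable_mul _ _) (integrable_mul _ _)]
    congr 2
    funext z
    rw [add_apply, map_add]
    ring
  smul_left f g c := by
    simp only [pairing]
    rw [mul_left_comm]
    congr 1
    rw [← integral_const_mul]
    congr 1
    funext z
    rw [smul_apply, map_mul]
    ring
  definite f h := by
    have h0 := hħ.out
    change pairing f f = 0 at h
    rw [pairing_self, Complex.ofReal_eq_zero] at h
    have hc : ((2 * Real.pi * ħ) ^ Module.finrank ℂ (JSpace J))⁻¹ ≠ 0 := by positivity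
    have h1 := (mul_eq_zero.1 h).resolve_left hc
    have hnn : 0 ≤ fun z => ‖f z‖ ^ 2 * fockWeight J ħ z := fun z =>
      mul_nonneg (by positivity) (fockWeight_pos J ħ z).le
    rw [integral_eq_zero_iff_of_nonneg hnn f.2.2] at h1
    have h2 := (Continuous.ae_eq_iff_eq volume
      ((f.continuous.norm.pow 2).mul (fockWeight_continuous J ħ)) continuous_const).1 h1
    refine FockSpace.ext fun z => ?_
    have h3 : ‖f z‖ ^ 2 * fockWeight J ħ z = 0 := congrFun h2 z
    have h4 := (mul_eq_zero.1 h3).resolve_right (fockWeight_pos J ħ z).ne'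
    exact norm_eq_zero.1 (pow_eq_zero_iff two_ne_zero |>.1 h4)

instance : NormedAddCommGroup (FockSpace J ħ) :=
  @InnerProductSpace.Core.toNormedAddCommGroup ℂ (FockSpace J ħ) _ _ _ (core J ħ)

instance : InnerProductSpace ℂ (FockSpace J ħ) := InnerProductSpace.ofCore (core J ħ).toCore

theorem inner_eq_pairing (f g : FockSpace J ħ) : inner ℂ f g = pairing g f := rfl

end FockSpace

theorem herm_differentiable (J : PCCS Ω) (v : JSpace J) :
    Differentiable ℂ (fun z : JSpace J => herm J z v) :=
  (innerSL ℂ v).differentiable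

theorem herm_div_differentiable (J : PCCS Ω) (v : JSpace J) (c : ℂ) :
    Differentiable ℂ (fun z : JSpace J => herm J z v / c) := by
  simp only [div_eq_mul_inv]
  exact (herm_differentiable J v).mul_const _

theorem norm_sq_exp_mul_weight (J : PCCS Ω) {ħ : ℝ} (hħ : 0 < ħ) (z v : JSpace J) :
    ‖Complex.exp (herm J z v / (2 * ħ))‖ ^ 2 * fockWeight J ħ z
      = Real.exp (‖v‖ ^ 2 / (2 * ħ)) * fockWeight J ħ (z - v) := by
  have h := @norm_sub_sq ℂ (JSpace J) _ _ _ z v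
  rw [← inner_re_symm, inner_eq_herm, RCLike.re_to_complex] at h
  have h2 : (herm J z v / (2 * ħ)).re = (herm J z v).re / (2 * ħ) := by
    have : (2 * (ħ : ℂ)) = ((2 * ħ : ℝ) : ℂ) := by push_cast; rfl
    rw [this, Complex.div_ofReal_re]
  rw [Complex.norm_exp, h2, fockWeight, fockWeight, h, ← Real.exp_nat_mul, ← Real.exp_add,
    ← Real.exp_add]
  congr 1
  field_simp
  push_cast
  ring

theorem fockWeight_integrable (J : PCCS Ω) {ħ : ℝ} (hħ : 0 < ħ) :
    Integrable (fockWeight J ħ) volume := by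
  have h := GaussianFourier.integrable_cexp_neg_mul_sq_norm_add (V := JSpace J)
    (b := ((1 / (2 * ħ) : ℝ) : ℂ)) (by rw [Complex.ofReal_re]; positivity) 0 0
  refine h.norm.congr (Filter.Eventually.of_forall fun z => ?_)
  simp only [Complex.norm_exp, fockWeight]
  congr 1
  rw [zero_mul, add_zero, ← Complex.ofReal_neg, ← Complex.ofReal_pow, ← Complex.ofReal_mul,
    Complex.ofReal_re]
  ring

/-- The coherent state `e_v(z) = exp(⟨z,v⟩_j/2ħ)`. -/
def coherent (J : PCCS Ω) (ħ : ℝ) [hħ : Fact (0 < ħ)] (v : JSpace J) : FockSpace J ħ :=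
  ⟨fun z => Complex.exp (herm J z v / (2 * ħ)),
    (herm_div_differentiable J v _).cexp, by
      simp only [norm_sq_exp_mul_weight J hħ.out]
      exact ((fockWeight_integrable J hħ.out).comp_sub_right v).const_mul _⟩

/-- The exponential factor of `U_j(v,t)`. -/
def heisFactor (J : PCCS Ω) (ħ : ℝ) (x : Heisenberg Ω) (z : JSpace J) : ℂ :=
  Complex.exp (-Complex.I * x.t / ħ + herm J z (toJ J x.v) / (2 * ħ)
    - (‖toJ J x.v‖ : ℂ) ^ 2 / (4 * ħ))

theorem norm_heisFactor_sq (J : PCCS Ω) {ħ : ℝ} (hħ : 0 < ħ) (x : Heisenberg Ω)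
    (z : JSpace J) : ‖heisFactor J ħ x z‖ ^ 2 * fockWeight J ħ z
      = fockWeight J ħ (z - toJ J x.v) := by
  have h1 : heisFactor J ħ x z = Complex.exp (((-x.t / ħ : ℝ) : ℂ) * Complex.I)
      * Complex.exp (herm J z (toJ J x.v) / (2 * ħ))
      * ((Real.exp (-(‖toJ J x.v‖ ^ 2 / (4 * ħ))) : ℝ) : ℂ) := by
    rw [heisFactor, Complex.ofReal_exp, ← Complex.exp_add, ← Complex.exp_add]
    congr 1
    push_cast
    ring
  rw [h1, norm_mul, norm_mul, Complex.norm_exp_ofReal_mul_I, one_mul, mul_pow, mul_right_comm,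
    norm_sq_exp_mul_weight J hħ, Complex.norm_real, Real.norm_of_nonneg (Real.exp_pos _).le,
    ← Real.exp_nat_mul, mul_right_comm, ← Real.exp_add]
  have h2 : ‖toJ J x.v‖ ^ 2 / (2 * ħ) + ((2 : ℕ) : ℝ) * -(‖toJ J x.v‖ ^ 2 / (4 * ħ)) = 0 := by
    field_simp
    push_cast
    ring
  rw [h2, Real.exp_zero, one_mul]

/-- The operator
`(U_j(v,t)f)(z) = exp(-it/ħ + ⟨z,v⟩_j/2ħ - |v|_j²/4ħ) f(z-v)`. -/
def heisOp (J : PCCS Ω) (ħ : ℝ) [hħ : Fact (0 < ħ)] (x : Heisenberg Ω) :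
    FockSpace J ħ →ₗ[ℂ] FockSpace J ħ where
  toFun f := ⟨fun z => heisFactor J ħ x z * f (z - toJ J x.v), by
    constructor
    · refine Differentiable.mul ?_ (f.2.1.comp (differentiable_id.sub_const _))
      exact (((herm_div_differentiable J _ _).const_add _).sub_const _).cexp
    · refine (f.2.2.comp_sub_right (toJ J x.v)).congr (Filter.Eventually.of_forall fun z => ?_)
      simp only [norm_mul, mul_pow]
      rw [← norm_heisFactor_sq J hħ.out x z]
      ring⟩
  map_add' f g := FockSpace.ext fun z => by
    change heisFactor J ħ x z * (f + g) (z - toJ J x.v)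
      = heisFactor J ħ x z * f (z - toJ J x.v) + heisFactor J ħ x z * g (z - toJ J x.v)
    rw [FockSpace.add_apply, mul_add]
  map_smul' c f := FockSpace.ext fun z => by
    change heisFactor J ħ x z * (c • f) (z - toJ J x.v)
      = c * (heisFactor J ħ x z * f (z - toJ J x.v))
    rw [FockSpace.smul_apply, mul_left_comm]

theorem heisOp_apply (J : PCCS Ω) (ħ : ℝ) [Fact (0 < ħ)] (x : Heisenberg Ω)
    (f : FockSpace J ħ) (z : JSpace J) :
    heisOp J ħ x f z = heisFactor J ħ x z * f (z - toJ J x.v) := rfl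

theorem norm_sq_toJ (J : PCCS Ω) (v : V) :
    (‖toJ J v‖ : ℂ) ^ 2 = herm J (toJ J v) (toJ J v) :=
  (inner_self_eq_norm_sq_to_K (𝕜 := ℂ) (toJ J v)).symm

theorem heisFactor_mul (J : PCCS Ω) {ħ : ℝ} (hħ : 0 < ħ) (x y : Heisenberg Ω)
    (z : JSpace J) :
    heisFactor J ħ (x * y) z
      = heisFactor J ħ x z * heisFactor J ħ y (z - toJ J x.v) := by
  have h0 : (ħ : ℂ) ≠ 0 := by exact_mod_cast hħ.ne'
  simp only [heisFactor, norm_sq_toJ]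
  rw [← Complex.exp_add]
  congr 1
  simp only [herm, Heisenberg.mul_def, map_add, map_sub, AddEquiv.symm_apply_apply,
    LinearMap.add_apply, LinearMap.sub_apply, J.form_j_symm y.v x.v, Ω.swap y.v x.v]
  push_cast
  field_simp
  ring

/-- The Fock representation `U_j` of the Heisenberg group. -/
def fockRep (J : PCCS Ω) (ħ : ℝ) [hħ : Fact (0 < ħ)] :
    Representation ℂ (Heisenberg Ω) (FockSpace J ħ) where
  toFun x := heisOp J ħ x
  map_one' := by
    refine LinearMap.ext fun f => FockSpace.ext fun z => ?_
    rw [heisOp_apply]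
    simp [heisFactor, Heisenberg.one_def, herm]
  map_mul' x y := by
    refine LinearMap.ext fun f => FockSpace.ext fun z => ?_
    change heisFactor J ħ (x * y) z * f (z - toJ J (x * y).v)
      = heisFactor J ħ x z
        * (heisFactor J ħ y (z - toJ J x.v) * f (z - toJ J x.v - toJ J y.v))
    rw [heisFactor_mul J hħ.out, mul_assoc]
    simp only [Heisenberg.mul_def, map_add, sub_sub]

/-- The Berezin kernel `A(z,w) = (A e_w)(z)`. -/
def berezinKernel {J : PCCS Ω} {ħ : ℝ} [Fact (0 < ħ)]
    (A : FockSpace J ħ → FockSpace J ħ) (z w : JSpace J) : ℂ :=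
  A (coherent J ħ w) z

/-! ### The group `Mp^c` -/

/-- The group of pairs `(U,g)` with `U` a unitary transformation of the Fock space,
`g ∈ Sp(V,Ω)` and `U_j(g·x) = U U_j(x) U⁻¹` for all `x` in the Heisenberg group. -/
def Mpc (J : PCCS Ω) (ħ : ℝ) [Fact (0 < ħ)] :
    Subgroup ((FockSpace J ħ ≃ₗᵢ[ℂ] FockSpace J ħ) × Sp Ω) where
  carrier := {p | ∀ x f, fockRep J ħ (spAct p.2 x) f = p.1 (fockRep J ħ x (p.1⁻¹ f))}
  mul_mem' := by
    intro a b ha hb x f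
    have h1 := ha (spAct b.2 x) f
    rw [hb x (a.1⁻¹ f)] at h1
    exact h1
  one_mem' := fun _ _ => rfl
  inv_mem' := by
    intro a ha x f
    have h1 := ha (spAct a.2⁻¹ x) (a.1 f)
    have h2 : spAct a.2 (spAct a.2⁻¹ x) = x := by
      simp [spAct]
    have h3 : ∀ k, a.1⁻¹ (a.1 k) = k := a.1.symm_apply_apply
    rw [h2, h3] at h1
    change _ = a.1⁻¹ (fockRep J ħ x (a.1 f))
    rw [h1, h3]
    rfl

/-! ### The parameters `C_g`, `Z_g` -/

/-- The linear part `C_g = (g - jgj)/2` of `g`. -/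
def linPart (J : PCCS Ω) (g : Sp Ω) : JSpace J →ₗ[ℂ] JSpace J where
  toFun z := toJ J ((1 / 2 : ℝ) • ((g : V ≃ₗ[ℝ] V) ((toJ J).symm z)
    - J.j ((g : V ≃ₗ[ℝ] V) (J.j ((toJ J).symm z)))))
  map_add' x y := by
    rw [← map_add]
    congr 1
    simp only [map_add]
    module
  map_smul' c x := by
    obtain ⟨v, rfl⟩ := (toJ J).surjective x
    rw [smul_toJ, RingHom.id_apply, smul_toJ]
    congr 1
    simp only [AddEquiv.symm_apply_apply, map_add, map_sub, map_smul, J.sq, map_neg]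
    module

/-- The antilinear part `D_g = (g + jgj)/2` of `g`. -/
def antiPart (J : PCCS Ω) (g : Sp Ω) : JSpace J →ₛₗ[starRingEnd ℂ] JSpace J where
  toFun z := toJ J ((1 / 2 : ℝ) • ((g : V ≃ₗ[ℝ] V) ((toJ J).symm z)
    + J.j ((g : V ≃ₗ[ℝ] V) (J.j ((toJ J).symm z)))))
  map_add' x y := by
    rw [← map_add]
    congr 1
    simp only [map_add]
    module
  map_smul' c x := by
    obtain ⟨v, rfl⟩ := (toJ J).surjective x
    rw [smul_toJ, smul_toJ, Complex.conj_re, Complex.conj_im]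
    congr 1
    simp only [AddEquiv.symm_apply_apply, map_add, map_smul, J.sq, map_neg]
    module

theorem linPart_injective (J : PCCS Ω) (g : Sp Ω) : Function.Injective (linPart J g) := by
  rw [injective_iff_map_eq_zero]
  intro z hz
  obtain ⟨v, rfl⟩ := (toJ J).surjective z
  by_contra hv
  have hv : v ≠ 0 := by simpa using hv
  have h1 : (g : V ≃ₗ[ℝ] V) v = J.j ((g : V ≃ₗ[ℝ] V) (J.j v)) := by
    have : (1 / 2 : ℝ) • ((g : V ≃ₗ[ℝ] V) v - J.j ((g : V ≃ₗ[ℝ] V) (J.j v))) = 0 := by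
      simpa [linPart] using hz
    exact sub_eq_zero.1 ((smul_eq_zero.1 this).resolve_left (by norm_num))
  have h2 := J.pos _ hv
  have h3 : Ω.form ((g : V ≃ₗ[ℝ] V) v) ((g : V ≃ₗ[ℝ] V) (J.j v)) = Ω.form v (J.j v) :=
    g.2 v (J.j v)
  have h4 : (g : V ≃ₗ[ℝ] V) (J.j v) ≠ 0 := by
    intro h0
    rw [h0, map_zero] at h3
    linarith
  have h5 := J.pos _ h4
  rw [← h3, h1, J.form_j_left, ← J.form_j_symm] at h2
  rw [J.form_j_symm] at h5
  linarith

/-- `C_g` as an element of `GL(V,j)`. -/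
def Cg (J : PCCS Ω) (g : Sp Ω) : JSpace J ≃ₗ[ℂ] JSpace J :=
  LinearEquiv.ofInjectiveEndo (linPart J g) (linPart_injective J g)

theorem Cg_apply (J : PCCS Ω) (g : Sp Ω) (z : JSpace J) : Cg J g z = linPart J g z := rfl

/-- `Z_g = C_g⁻¹ D_g`. -/
def Zg (J : PCCS Ω) (g : Sp Ω) : JSpace J →ₛₗ[starRingEnd ℂ] JSpace J :=
  ((Cg J g).symm : JSpace J →ₗ[ℂ] JSpace J).comp (antiPart J g)

/-- The `ℂ`-linear map `1 - Z_{g₁} Z_{g₂⁻¹}`. -/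
def oneSubZZ (J : PCCS Ω) (g₁ g₂ : Sp Ω) : JSpace J →L[ℂ] JSpace J :=
  LinearMap.toContinuousLinearMap (LinearMap.id - (Zg J g₁).comp (Zg J g₂⁻¹))

/-- `GL(V,j)_+`: the invertible `ℂ`-linear `A` with `A + A*` positive definite. -/
def GLplus (J : PCCS Ω) : Set (JSpace J →L[ℂ] JSpace J) :=
  {A | IsUnit A ∧ ∀ v, v ≠ 0 → 0 < (herm J ((A + ContinuousLinearMap.adjoint A) v) v).re}

/-- `a` is, on `GL(V,j)_+`, a holomorphic logarithm of `det` with `a(1) = 0`. -/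
structure IsLogDet (J : PCCS Ω) (a : (JSpace J →L[ℂ] JSpace J) → ℂ) : Prop where
  holomorphic : DifferentiableOn ℂ a (GLplus J)
  exp_eq : ∀ A ∈ GLplus J, LinearMap.det (A : JSpace J →ₗ[ℂ] JSpace J) = Complex.exp (a A)
  one_eq : a 1 = 0

/-- The element `x = (U,g₀)` of `Mp^c` has parameters `g, c`: `g₀ = g`, `|c² det C_g| = 1`, and
`U(z,v) = c exp (1/4ħ) {2⟨C_g⁻¹z,v⟩_j - ⟨z,Z_{g⁻¹}z⟩_j - ⟨Z_g v,v⟩_j}`. -/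
structure HasParameters {J : PCCS Ω} {ħ : ℝ} [Fact (0 < ħ)] (x : Mpc J ħ) (g : Sp Ω) (c : ℂ) :
    Prop where
  sp_eq : x.1.2 = g
  norm_eq : ‖c ^ 2 * LinearMap.det (Cg J g : JSpace J →ₗ[ℂ] JSpace J)‖ = 1
  kernel_eq : ∀ z v : JSpace J, berezinKernel x.1.1 z v =
    c * Complex.exp (1 / (4 * ħ) * (2 * herm J ((Cg J g).symm z) v
      - herm J z (Zg J g⁻¹ z) - herm J (Zg J g v) v))

end

end SymplecticMpc

/-!
Write `K(z,v) = (U e_v)(z)` for the Berezin kernel of `(U,g) ∈ Mp^c`, and `⟨z,w⟩_j = inner ℂ w z`.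

**Form of the kernel** (`berezinKernel_eq`). The coherent states are the Heisenberg translates of
`e_0 = 1`, so covariance expresses `K(z,v)` through `F = U e_0` evaluated at `z - g v`. By the
reproducing property `(f, e_v)_j = f(v)` (`FockSpace.pairing_coherent`), which is the mean value
property for the rotation-invariant Gaussian weight, `K` is antiholomorphic in `v`, being the
adjoint of the kernel of `U⁻¹`. Dividing `F` by `exp(-⟨z, Z_{g⁻¹} z⟩_j/4ħ)` gives a holomorphic
function whose composition with `v ↦ -g v` is antiholomorphic; as `C_g` is invertible, such a
function is constant (`eq_const_of_antiholomorphic_comp`). Hence `K` has the asserted form, with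
`λ = K(0,0)`. The algebra behind this rests on `C_g* = C_{g⁻¹}`, on the symmetry of the antilinear
map `Z_g`, and on `1 - Z_{g⁻¹}² = C_{g⁻¹}⁻¹ C_g⁻¹`, which also gives `‖Z_g‖ < 1`.

**The logarithm of the determinant.** `GL(V,j)_+` is the open convex set of strictly accretive maps,
so `det` has a holomorphic logarithm on it, unique once its value at `1` is fixed.

**Composition** (`berezinKernel_mul_zero`). The scalar of `U₁ U₂` is the pairing of `U₂ e_0` with
`U₁⁻¹ e_0`, that is `λ₁ λ₂` times the Gaussian integral
`I(t) = (2πħ)⁻ⁿ ∫ exp(-(2|z|² + t⟨z, A z⟩_j + ⟨B z, z⟩_j)/4ħ) dz` at `t = 1`, with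
`A = Z_{g₂⁻¹}` and `B = Z_{g₁}`. Integration by parts determines the second moments of the integrand and gives
`I'(t) = ½ tr((1 - t B A)⁻¹ B A) I(t)`, while Jacobi's formula gives
`d/dt a(1 - t B A) = -tr((1 - t B A)⁻¹ B A)`. So `I(t) exp(½ a(1 - t B A))` is constant, and it
is `1` at `t = 0` by the mean value property (`integral_gauss`). No branch of a square root has to be
chosen: `a` provides it along the segment.

**Normalisation** (`norm_sq_mul_det_eq_one`). The composition formula for `U⁻¹ U = 1`, together with
`|det(1 - Z_{g⁻¹}²)| = |det C_g|⁻²`, is the condition `|λ² det C_g| = 1`.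
-/

open MeasureTheory

namespace SymplecticMpc

noncomputable section

/-! ### The maps `C_g`, `D_g` and `Z_g` -/

section Parameters

variable {V : Type*} [AddCommGroup V] [Module ℝ V] {Ω : SymplecticForm V}

theorem linPart_add_antiPart (J : PCCS Ω) (g : Sp Ω) (z : JSpace J) :
    linPart J g z + antiPart J g z = toJ J ((g : V ≃ₗ[ℝ] V) ((toJ J).symm z)) := by
  change toJ J _ + toJ J _ = _
  rw [← map_add]
  congr 1
  module

theorem linPart_mul (J : PCCS Ω) (g h : Sp Ω) (z : JSpace J) :
    linPart J (g * h) z = linPart J g (linPart J h z) + antiPart J g (antiPart J h z) := by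
  obtain ⟨v, rfl⟩ := (toJ J).surjective z
  change toJ J _ = toJ J _ + toJ J _
  rw [← map_add]
  congr 1
  simp only [linPart, antiPart, LinearMap.coe_mk, AddHom.coe_mk, AddEquiv.symm_apply_apply,
    map_add, map_sub, map_smul, J.sq, map_neg, Subgroup.coe_mul, LinearEquiv.mul_apply]
  module

theorem antiPart_mul (J : PCCS Ω) (g h : Sp Ω) (z : JSpace J) :
    antiPart J (g * h) z = linPart J g (antiPart J h z) + antiPart J g (linPart J h z) := by
  obtain ⟨v, rfl⟩ := (toJ J).surjective z
  change toJ J _ = toJ J _ + toJ J _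
  rw [← map_add]
  congr 1
  simp only [linPart, antiPart, LinearMap.coe_mk, AddHom.coe_mk, AddEquiv.symm_apply_apply,
    map_add, map_sub, map_smul, J.sq, map_neg, Subgroup.coe_mul, LinearEquiv.mul_apply]
  module

theorem linPart_one (J : PCCS Ω) (z : JSpace J) : linPart J 1 z = z := by
  obtain ⟨v, rfl⟩ := (toJ J).surjective z
  change toJ J _ = _
  congr 1
  simp only [AddEquiv.symm_apply_apply, Subgroup.coe_one, LinearEquiv.coe_one, id_eq, J.sq]
  module

theorem antiPart_one (J : PCCS Ω) (z : JSpace J) : antiPart J 1 z = 0 := by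
  obtain ⟨v, rfl⟩ := (toJ J).surjective z
  change toJ J _ = toJ J 0
  congr 1
  simp only [AddEquiv.symm_apply_apply, Subgroup.coe_one, LinearEquiv.coe_one, id_eq, J.sq]
  module

theorem form_inv_left (g : Sp Ω) (v w : V) :
    Ω.form (((g⁻¹ : Sp Ω) : V ≃ₗ[ℝ] V) v) w = Ω.form v ((g : V ≃ₗ[ℝ] V) w) := by
  rw [← g.2]
  simp

/-- The adjoint of `C_g` is `C_{g⁻¹}`. -/
theorem inner_linPart (J : PCCS Ω) (g : Sp Ω) (z w : JSpace J) :
    inner ℂ (linPart J g z) w = inner ℂ z (linPart J g⁻¹ w) := by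
  obtain ⟨v, rfl⟩ := (toJ J).surjective z
  obtain ⟨u, rfl⟩ := (toJ J).surjective w
  simp only [inner_eq_herm, herm, linPart, LinearMap.coe_mk, AddHom.coe_mk,
    AddEquiv.symm_apply_apply, map_sub, map_smul, J.sq, map_neg, LinearMap.sub_apply,
    LinearMap.smul_apply, J.form_j_left, form_inv_left]
  push_cast [smul_eq_mul]
  ring

/-- The antilinear map `D_g` has transpose `-D_{g⁻¹}`. -/
theorem inner_antiPart (J : PCCS Ω) (g : Sp Ω) (z w : JSpace J) :
    inner ℂ (antiPart J g z) w = -inner ℂ (antiPart J g⁻¹ w) z := by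
  rw [← inner_conj_symm (antiPart J g⁻¹ w)]
  obtain ⟨v, rfl⟩ := (toJ J).surjective z
  obtain ⟨u, rfl⟩ := (toJ J).surjective w
  simp only [inner_eq_herm, herm, antiPart, LinearMap.coe_mk, AddHom.coe_mk,
    AddEquiv.symm_apply_apply, map_add, map_smul, J.sq, map_neg, LinearMap.add_apply,
    LinearMap.smul_apply, J.form_j_left, form_inv_left]
  simp only [map_sub, map_mul, Complex.conj_ofReal, Complex.conj_I]
  push_cast [smul_eq_mul]
  ring

theorem linPart_inv_linPart (J : PCCS Ω) (g : Sp Ω) (z : JSpace J) :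
    linPart J g⁻¹ (linPart J g z) + antiPart J g⁻¹ (antiPart J g z) = z := by
  rw [← linPart_mul, inv_mul_cancel, linPart_one]

theorem linPart_inv_antiPart (J : PCCS Ω) (g : Sp Ω) (z : JSpace J) :
    linPart J g⁻¹ (antiPart J g z) + antiPart J g⁻¹ (linPart J g z) = 0 := by
  rw [← antiPart_mul, inv_mul_cancel, antiPart_one]

variable [FiniteDimensional ℝ V]

theorem linPart_Cg_symm (J : PCCS Ω) (g : Sp Ω) (z : JSpace J) :
    linPart J g ((Cg J g).symm z) = z :=
  (Cg J g).apply_symm_apply z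

theorem Cg_symm_linPart (J : PCCS Ω) (g : Sp Ω) (z : JSpace J) :
    (Cg J g).symm (linPart J g z) = z :=
  (Cg J g).symm_apply_apply z

theorem Zg_apply (J : PCCS Ω) (g : Sp Ω) (z : JSpace J) :
    Zg J g z = (Cg J g).symm (antiPart J g z) := rfl

theorem inner_Cg_symm (J : PCCS Ω) (g : Sp Ω) (z w : JSpace J) :
    inner ℂ ((Cg J g).symm z) w = inner ℂ z ((Cg J g⁻¹).symm w) := by
  conv_lhs => rw [← linPart_Cg_symm J g⁻¹ w]
  rw [← inner_linPart, linPart_Cg_symm]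

theorem Zg_inv_linPart (J : PCCS Ω) (g : Sp Ω) (z : JSpace J) :
    Zg J g⁻¹ (linPart J g z) = -antiPart J g z := by
  rw [Zg_apply, LinearEquiv.symm_apply_eq, Cg_apply, map_neg, eq_neg_iff_add_eq_zero, add_comm,
    linPart_inv_antiPart]

/-- The antilinear map `Z_g` is symmetric. -/
theorem inner_Zg (J : PCCS Ω) (g : Sp Ω) (z w : JSpace J) :
    inner ℂ (Zg J g z) w = inner ℂ (Zg J g w) z := by
  obtain ⟨h, rfl⟩ : ∃ h : Sp Ω, h⁻¹ = g := ⟨g⁻¹, inv_inv g⟩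
  have h1 : Zg J h⁻¹ w = -antiPart J h ((Cg J h).symm w) := by
    rw [← Zg_inv_linPart, linPart_Cg_symm]
  rw [h1, inner_neg_left, inner_antiPart, neg_neg, Zg_apply, inner_Cg_symm, inv_inv]

/-- `1 - Z_g² = C_g⁻¹ (C_g⁻¹)*`, written with `g⁻¹` in place of `g`. -/
theorem sub_Zg_inv_Zg_inv (J : PCCS Ω) (g : Sp Ω) (z : JSpace J) :
    z - Zg J g⁻¹ (Zg J g⁻¹ z) = (Cg J g⁻¹).symm ((Cg J g).symm z) := by
  have h1 : Zg J g⁻¹ z = -antiPart J g ((Cg J g).symm z) := by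
    rw [← Zg_inv_linPart, linPart_Cg_symm]
  rw [h1, map_neg, Zg_apply, sub_neg_eq_add, LinearEquiv.eq_symm_apply, map_add, Cg_apply,
    LinearEquiv.apply_symm_apply]
  conv_lhs => rw [← linPart_Cg_symm J g z]
  rw [Cg_symm_linPart, linPart_inv_linPart]

/-- The exact defect of contractivity of `Z_g`. -/
theorem norm_sq_sub_norm_Zg_sq (J : PCCS Ω) (g : Sp Ω) (z : JSpace J) :
    ‖z‖ ^ 2 - ‖Zg J g z‖ ^ 2 = ‖(Cg J g⁻¹).symm z‖ ^ 2 := by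
  obtain ⟨h, rfl⟩ : ∃ h : Sp Ω, h⁻¹ = g := ⟨g⁻¹, inv_inv g⟩
  have h1 : inner ℂ (z - Zg J h⁻¹ (Zg J h⁻¹ z)) z
      = inner ℂ ((Cg J h⁻¹).symm ((Cg J h).symm z)) z := by rw [sub_Zg_inv_Zg_inv]
  rw [inner_sub_left, inner_Zg, inner_Cg_symm, inv_inv] at h1
  simp only [inner_self_eq_norm_sq_to_K] at h1
  rw [inv_inv]
  exact_mod_cast h1

theorem exists_norm_Zg_le (J : PCCS Ω) (g : Sp Ω) :
    ∃ k : ℝ, 0 ≤ k ∧ k < 1 ∧ ∀ z, ‖Zg J g z‖ ≤ k * ‖z‖ := by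
  -- `‖z‖² - ‖Z_g z‖²` is bounded below by a multiple of `‖z‖²` because `C_{g⁻¹}` is bounded.
  let L : JSpace J →L[ℂ] JSpace J := LinearMap.toContinuousLinearMap (linPart J g⁻¹)
  obtain ⟨M, hM, hL⟩ : ∃ M : ℝ, 1 < M ∧ ∀ z, ‖z‖ ≤ M * ‖(Cg J g⁻¹).symm z‖ := by
    refine ⟨‖L‖ + 2, by linarith [norm_nonneg L], fun z => ?_⟩
    have h1 := L.le_opNorm ((Cg J g⁻¹).symm z)
    have h2 : L ((Cg J g⁻¹).symm z) = z := linPart_Cg_symm J g⁻¹ z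
    rw [h2] at h1
    nlinarith [norm_nonneg ((Cg J g⁻¹).symm z)]
  have hM2 : (M ^ 2)⁻¹ < 1 := inv_lt_one_of_one_lt₀ (by nlinarith)
  have hM3 : 0 < (M ^ 2)⁻¹ := by positivity
  refine ⟨√(1 - (M ^ 2)⁻¹), Real.sqrt_nonneg _, ?_, fun z => ?_⟩
  · rw [Real.sqrt_lt' one_pos]
    linarith
  · have h1 := norm_sq_sub_norm_Zg_sq J g z
    have h2 : ‖z‖ ^ 2 ≤ M ^ 2 * ‖(Cg J g⁻¹).symm z‖ ^ 2 := by
      rw [← mul_pow]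
      exact pow_le_pow_left₀ (norm_nonneg z) (hL z) 2
    have h3 : (M ^ 2)⁻¹ * ‖z‖ ^ 2 ≤ ‖(Cg J g⁻¹).symm z‖ ^ 2 := by
      rwa [inv_mul_le_iff₀ (by positivity)]
    refine abs_le_of_sq_le_sq' ?_ (by positivity) |>.2
    rw [mul_pow, Real.sq_sqrt (by linarith)]
    linarith

/-- `Z_g` as a continuous antilinear map. -/
def ZgL (J : PCCS Ω) (g : Sp Ω) : JSpace J →L⋆[ℂ] JSpace J :=
  (Zg J g).mkContinuousOfExistsBound
    ((exists_norm_Zg_le J g).imp fun _ h => h.2.2)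

theorem ZgL_apply (J : PCCS Ω) (g : Sp Ω) (z : JSpace J) : ZgL J g z = Zg J g z := rfl

/-- The identity that turns covariance under the Heisenberg group into the parametrised form of
the Berezin kernel. -/
theorem kernel_exponent (J : PCCS Ω) (g : Sp Ω) (z v : JSpace J) :
    let u := linPart J g v + antiPart J g v
    2 * inner ℂ v ((Cg J g).symm z) - inner ℂ (Zg J g⁻¹ z) z - inner ℂ v (Zg J g v)
      = inner ℂ v v + 2 * inner ℂ u z - inner ℂ u u - inner ℂ (Zg J g⁻¹ (z - u)) (z - u) := by
  intro u
  have h1 : u + Zg J g⁻¹ u = (Cg J g⁻¹).symm v := by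
    rw [LinearEquiv.eq_symm_apply, map_add, Zg_apply, LinearEquiv.apply_symm_apply, Cg_apply]
    calc linPart J g⁻¹ u + antiPart J g⁻¹ u
        = (linPart J g⁻¹ (linPart J g v) + antiPart J g⁻¹ (antiPart J g v))
          + (linPart J g⁻¹ (antiPart J g v) + antiPart J g⁻¹ (linPart J g v)) := by
          simp only [u, map_add]; abel
      _ = v := by rw [linPart_inv_linPart, linPart_inv_antiPart, add_zero]
  have h2 : (Cg J g).symm u = v + Zg J g v := by
    rw [map_add, Cg_symm_linPart, Zg_apply]
  have h3 : inner ℂ v ((Cg J g).symm z) = inner ℂ u z + inner ℂ (Zg J g⁻¹ u) z := by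
    rw [← inner_add_left, h1, inner_Cg_symm, inv_inv]
  have h4 : inner ℂ v v + inner ℂ v (Zg J g v) = inner ℂ u u + inner ℂ (Zg J g⁻¹ u) u := by
    rw [← inner_add_left, ← inner_add_right, h1, ← h2, inner_Cg_symm, inv_inv]
  have h5 := inner_Zg J g⁻¹ z u
  simp only [map_sub, inner_sub_left, inner_sub_right]
  linear_combination 2 * h3 - h4 - h5

end Parameters

/-! ### The reproducing property of coherent states -/

section Reproducing

variable {V : Type*} [AddCommGroup V] [Module ℝ V] [FiniteDimensional ℝ V] {Ω : SymplecticForm V}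

/-- Scalar multiplication by a complex number of modulus one, as a real isometry. -/
def rotation (J : PCCS Ω) (c : ℂ) (hc : ‖c‖ = 1) : JSpace J ≃ₗᵢ[ℝ] JSpace J where
  toLinearEquiv := (LinearEquiv.smulOfNeZero ℂ (JSpace J) c
    (by rintro rfl; simp at hc)).restrictScalars ℝ
  norm_map' z := by
    change ‖c • z‖ = ‖z‖
    rw [norm_smul, hc, one_mul]

/-- The mean value property for the Gaussian weight: the weight is invariant under the rotations
`z ↦ e^{iθ} z`, and the average of a holomorphic function over a circle centred at `0` is its
value at `0`. -/
theorem integral_mul_fockWeight {J : PCCS Ω} {ħ : ℝ} {h : JSpace J → ℂ}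
    (hd : Differentiable ℂ h)
    (hi : Integrable (fun z => h z * (fockWeight J ħ z : ℂ)) volume) :
    ∫ z, h z * (fockWeight J ħ z : ℂ) = h 0 * ∫ z, (fockWeight J ħ z : ℂ) := by
  have hn : ∀ θ : ℝ, ‖circleMap 0 1 θ‖ = 1 := fun θ => by simp
  have hw : ∀ (θ : ℝ) (z : JSpace J), fockWeight J ħ (circleMap 0 1 θ • z) = fockWeight J ħ z := by
    intro θ z
    rw [fockWeight, norm_smul, hn, one_mul, fockWeight]
  have hmp : ∀ θ : ℝ, MeasurePreserving (fun z : JSpace J => circleMap 0 1 θ • z) :=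
    fun θ => (rotation J _ (hn θ)).measurePreserving
  have hemb : ∀ θ : ℝ, MeasurableEmbedding (fun z : JSpace J => circleMap 0 1 θ • z) :=
    fun θ => (rotation J _ (hn θ)).toHomeomorph.measurableEmbedding
  have hrot : ∀ θ : ℝ, ∫ z, h (circleMap 0 1 θ • z) * (fockWeight J ħ z : ℂ)
      = ∫ z, h z * (fockWeight J ħ z : ℂ) := by
    intro θ
    rw [← (hmp θ).integral_comp (hemb θ) (fun z => h z * (fockWeight J ħ z : ℂ))]
    simp only [hw]
  have hint : ∀ θ : ℝ, Integrable (fun z => h (circleMap 0 1 θ • z) * (fockWeight J ħ z : ℂ)) := by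
    intro θ
    have := (hmp θ).integrable_comp_emb (hemb θ) |>.2 hi
    simpa only [Function.comp_def, hw] using this
  have hcont : Continuous (fun p : ℝ × JSpace J =>
      h (circleMap 0 1 p.1 • p.2) * (fockWeight J ħ p.2 : ℂ)) := by
    have h1 := hd.continuous
    have h2 := fockWeight_continuous J ħ
    have h3 : Continuous (circleMap 0 1) := continuous_circleMap 0 1
    fun_prop
  have hnorm : ∀ θ : ℝ, ∫ z, ‖h (circleMap 0 1 θ • z) * (fockWeight J ħ z : ℂ)‖
      = ∫ z, ‖h z * (fockWeight J ħ z : ℂ)‖ := by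
    intro θ
    rw [← (hmp θ).integral_comp (hemb θ) (fun z => ‖h z * (fockWeight J ħ z : ℂ)‖)]
    simp only [hw]
  have hprod : Integrable (Function.uncurry fun (θ : ℝ) (z : JSpace J) =>
      h (circleMap 0 1 θ • z) * (fockWeight J ħ z : ℂ))
      ((volume.restrict (Set.uIoc 0 (2 * Real.pi))).prod volume) := by
    refine (integrable_prod_iff hcont.aestronglyMeasurable).2 ?_
    refine ⟨Filter.Eventually.of_forall hint, ?_⟩
    simp only [hnorm]
    rw [Set.uIoc_of_le Real.two_pi_pos.le]
    exact integrable_const _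
  have hswap := intervalIntegral_integral_swap hprod
  have havg : ∀ z : JSpace J, ∫ θ in (0 : ℝ)..2 * Real.pi,
      h (circleMap 0 1 θ • z) * (fockWeight J ħ z : ℂ)
        = (2 * Real.pi : ℝ) * (h 0 * (fockWeight J ħ z : ℂ)) := by
    intro z
    have hdz : Differentiable ℂ (fun c : ℂ => h (c • z)) :=
      hd.comp (differentiable_id.smul_const z)
    have h1 := DiffContOnCl.circleAverage (c := 0) (R := 1)
      (hdz.diffContOnCl (s := Metric.ball 0 |1|))
    rw [Real.circleAverage_def, zero_smul, inv_smul_eq_iff₀ (by positivity)] at h1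
    rw [intervalIntegral.integral_mul_const, h1, Complex.real_smul, mul_assoc]
  simp only [hrot, havg] at hswap
  rw [intervalIntegral.integral_const, sub_zero, Complex.real_smul, integral_const_mul,
    integral_const_mul] at hswap
  exact mul_left_cancel₀ (by exact_mod_cast Real.two_pi_pos.ne') hswap

theorem integral_fockWeight (J : PCCS Ω) {ħ : ℝ} (hħ : 0 < ħ) :
    ∫ z, fockWeight J ħ z = (2 * Real.pi * ħ) ^ Module.finrank ℂ (JSpace J) := by
  have h := GaussianFourier.integral_rexp_neg_mul_sq_norm (V := JSpace J)
    (b := 1 / (2 * ħ)) (by positivity)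
  rw [finrank_real_of_complex] at h
  have h1 : ∀ z : JSpace J, fockWeight J ħ z = Real.exp (-(1 / (2 * ħ)) * ‖z‖ ^ 2) := by
    intro z
    rw [fockWeight]
    congr 1
    ring
  simp only [h1]
  rw [h, ← Real.rpow_natCast]
  congr 1
  · field_simp
  · push_cast
    ring

variable {J : PCCS Ω} {ħ : ℝ} [hħ : Fact (0 < ħ)]

theorem FockSpace.pairing_coherent (f : FockSpace J ħ) (v : JSpace J) :
    FockSpace.pairing f (coherent J ħ v) = f v := by
  have h0 := hħ.out
  have h0' : (ħ : ℂ) ≠ 0 := by exact_mod_cast h0.ne'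
  have hi := FockSpace.integrable_mul (coherent J ħ v) f
  have htr : ∀ z : JSpace J, starRingEnd ℂ (coherent J ħ v (z + v)) * f (z + v)
      * (fockWeight J ħ (z + v) : ℂ)
      = (f (z + v) * coherent J ħ (-v) z) * (fockWeight J ħ z : ℂ) := by
    intro z
    have h1 : starRingEnd ℂ (coherent J ħ v (z + v)) * (fockWeight J ħ (z + v) : ℂ)
        = coherent J ħ (-v) z * (fockWeight J ħ z : ℂ) := by
      change starRingEnd ℂ (Complex.exp _) * ((Real.exp _ : ℝ) : ℂ)
        = Complex.exp _ * ((Real.exp _ : ℝ) : ℂ)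
      rw [← Complex.exp_conj, Complex.ofReal_exp, Complex.ofReal_exp, ← Complex.exp_add,
        ← Complex.exp_add]
      congr 1
      have h2 : ∀ z : JSpace J, (‖z‖ : ℂ) ^ 2 = inner ℂ z z :=
        fun z => (inner_self_eq_norm_sq_to_K (𝕜 := ℂ) z).symm
      push_cast
      rw [h2, h2]
      simp only [← inner_eq_herm, map_div₀, map_mul, map_ofNat, Complex.conj_ofReal,
        inner_conj_symm, map_add, inner_add_left, inner_add_right, inner_neg_left]
      field_simp
      ring
    rw [mul_right_comm, h1]
    ring
  have hi' : Integrable (fun z => (f (z + v) * coherent J ħ (-v) z) * (fockWeight J ħ z : ℂ)) := by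
    simpa only [htr] using hi.comp_add_right v
  have hd : Differentiable ℂ (fun z => f (z + v) * coherent J ħ (-v) z) :=
    (f.2.1.comp (differentiable_id.add_const v)).mul (coherent J ħ (-v)).2.1
  rw [FockSpace.pairing, ← integral_add_right_eq_self _ v]
  simp only [htr]
  rw [integral_mul_fockWeight hd hi', integral_complex_ofReal, integral_fockWeight J h0]
  have h2 : coherent J ħ (-v) 0 = 1 := by
    change Complex.exp _ = 1
    simp [← inner_eq_herm]
  rw [h2, zero_add, mul_one, mul_left_comm, ← Complex.ofReal_mul, inv_mul_cancel₀ (by positivity),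
    Complex.ofReal_one, mul_one]

end Reproducing

/-! ### The Berezin kernel of an element of `Mp^c` -/

section Kernel

variable {V : Type*} [AddCommGroup V] [Module ℝ V] {Ω : SymplecticForm V} {J : PCCS Ω}

theorem norm_sq_eq_inner (z : JSpace J) : (‖z‖ : ℂ) ^ 2 = inner ℂ z z :=
  (inner_self_eq_norm_sq_to_K (𝕜 := ℂ) z).symm

/-- For antilinear `A` the form `⟨z, A z⟩` is holomorphic in `z`. -/
theorem differentiable_inner_antilinear (A : JSpace J →L⋆[ℂ] JSpace J) :
    Differentiable ℂ (fun z => inner ℂ (A z) z) := by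
  let β : JSpace J →L[ℂ] JSpace J →L[ℂ] ℂ := (innerSL ℂ).comp A
  change Differentiable ℂ (fun z => β z z)
  fun_prop

variable [FiniteDimensional ℝ V]

/-- A holomorphic function which becomes antiholomorphic after composition with the real-linear
map `v ↦ -(C_g v + D_g v)` is constant: the linear part of the derivative of the composition
is `-h' ∘ C_g`, and `C_g` is onto. -/
theorem eq_const_of_antiholomorphic_comp (g : Sp Ω) {h k : JSpace J → ℂ}
    (hh : Differentiable ℂ h) (hk : Differentiable ℂ k)
    (hhk : ∀ v, h (-(linPart J g v + antiPart J g v)) = starRingEnd ℂ (k v)) (z : JSpace J) :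
    h z = h 0 := by
  refine is_const_of_fderiv_eq_zero hh (fun p => ?_) z 0
  obtain ⟨v, hv⟩ : ∃ v, -(linPart J g v + antiPart J g v) = p := by
    refine ⟨toJ J ((g : V ≃ₗ[ℝ] V).symm ((toJ J).symm (-p))), ?_⟩
    rw [linPart_add_antiPart]
    simp
  have key : ∀ u, fderiv ℂ h p (linPart J g u + antiPart J g u)
      = -starRingEnd ℂ (fderiv ℂ k v u) := by
    intro u
    have hl : HasDerivAt (fun t : ℝ => p + t • (-(linPart J g u + antiPart J g u)))
        (-(linPart J g u + antiPart J g u)) 0 := by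
      simpa using ((hasDerivAt_id (0 : ℝ)).smul_const
        (-(linPart J g u + antiPart J g u))).const_add p
    have hr : HasDerivAt (fun t : ℝ => v + t • u) u 0 := by
      simpa using ((hasDerivAt_id (0 : ℝ)).smul_const u).const_add v
    have h1 := ((hh p).hasFDerivAt.restrictScalars ℝ).comp_hasDerivAt_of_eq (0 : ℝ) hl (by simp)
    have h2 := ((hk v).hasFDerivAt.restrictScalars ℝ).comp_hasDerivAt_of_eq (0 : ℝ) hr (by simp)
    have h3 := h2.star
    have h4 : (h ∘ fun t : ℝ => p + t • (-(linPart J g u + antiPart J g u)))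
        = fun t : ℝ => star ((k ∘ fun t : ℝ => v + t • u) t) := by
      funext t
      have h5 : p + t • (-(linPart J g u + antiPart J g u))
          = -(linPart J g (v + t • u) + antiPart J g (v + t • u)) := by
        have e1 : linPart J g (t • u) = t • linPart J g u := by
          rw [← Complex.coe_smul, map_smul, Complex.coe_smul]
        have e2 : antiPart J g (t • u) = t • antiPart J g u := by
          rw [← Complex.coe_smul, map_smulₛₗ, Complex.conj_ofReal, Complex.coe_smul]
        rw [map_add, map_add, e1, e2, ← hv]
        module
      simp only [Function.comp_apply, h5, hhk]
      rfl
    rw [h4] at h1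
    have h6 := h1.unique h3
    simp only [ContinuousLinearMap.coe_restrictScalars', map_neg] at h6
    rw [← neg_eq_iff_eq_neg]
    exact h6
  ext w
  obtain ⟨u, rfl⟩ : ∃ u, linPart J g u = w := ⟨_, linPart_Cg_symm J g w⟩
  -- The directions `u` and `i u` separate the linear from the antilinear part.
  have h1 := key u
  have h2 := key (Complex.I • u)
  simp only [map_add, map_smul, map_smulₛₗ, smul_eq_mul, Complex.conj_I, map_mul] at h1 h2
  rw [zero_apply]
  have h3 : Complex.I * (2 * fderiv ℂ h p (linPart J g u)) = 0 := by
    linear_combination h2 + Complex.I * h1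
  simpa using h3

variable {ħ : ℝ} [hħ : Fact (0 < ħ)]

theorem coherent_apply (v z : JSpace J) :
    coherent J ħ v z = Complex.exp (inner ℂ v z / (2 * ħ)) := rfl

theorem coherent_zero_apply (z : JSpace J) : coherent J ħ 0 z = 1 := by
  simp [coherent_apply]

/-- Translating the vacuum by the Heisenberg group gives the coherent states. -/
theorem coherent_eq_fockRep (v : V) :
    coherent J ħ (toJ J v) = Complex.exp (inner ℂ (toJ J v) (toJ J v) / (4 * ħ)) •
      fockRep J ħ ⟨v, 0⟩ (coherent J ħ 0) := by
  refine FockSpace.ext fun z => ?_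
  rw [FockSpace.smul_apply]
  change _ = _ * (heisFactor J ħ ⟨v, 0⟩ z * coherent J ħ 0 (z - toJ J v))
  rw [coherent_zero_apply, mul_one, heisFactor, ← Complex.exp_add, coherent_apply,
    norm_sq_eq_inner, ← inner_eq_herm]
  congr 1
  push_cast
  ring

theorem Mpc.covariance (x : Mpc J ħ) (y : Heisenberg Ω) (f : FockSpace J ħ) :
    x.1.1 (fockRep J ħ y f) = fockRep J ħ (spAct x.1.2 y) (x.1.1 f) := by
  have h : ∀ k, x.1.1⁻¹ (x.1.1 k) = k := x.1.1.symm_apply_apply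
  have := x.2 y (x.1.1 f)
  rw [this, h]

theorem berezinKernel_covariance (x : Mpc J ħ) (z v : JSpace J) :
    let u := linPart J x.1.2 v + antiPart J x.1.2 v
    berezinKernel x.1.1 z v = Complex.exp (1 / (4 * ħ) * (inner ℂ v v + 2 * inner ℂ u z
      - inner ℂ u u)) * x.1.1 (coherent J ħ 0) (z - u) := by
  intro u
  obtain ⟨v, rfl⟩ := (toJ J).surjective v
  have hu : u = toJ J ((x.1.2 : V ≃ₗ[ℝ] V) v) := linPart_add_antiPart J _ _
  rw [berezinKernel, coherent_eq_fockRep, map_smul, Mpc.covariance, FockSpace.smul_apply]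
  change _ * (heisFactor J ħ ⟨(x.1.2 : V ≃ₗ[ℝ] V) v, 0⟩ z * _) = _
  rw [← mul_assoc, heisFactor, ← Complex.exp_add]
  dsimp only
  rw [← hu, norm_sq_eq_inner, ← inner_eq_herm]
  congr 2
  · push_cast
    field_simp
    ring
  · rw [hu]
    rfl

/-- The Berezin kernel of the inverse operator is the adjoint kernel. -/
theorem conj_berezinKernel (U : FockSpace J ħ ≃ₗᵢ[ℂ] FockSpace J ħ) (z v : JSpace J) :
    starRingEnd ℂ (berezinKernel U z v) = berezinKernel (U⁻¹ : FockSpace J ħ ≃ₗᵢ[ℂ] _) v z := by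
  have h1 : ∀ (f : FockSpace J ħ) w, f w = inner ℂ (coherent J ħ w) f := fun f w =>
    (FockSpace.pairing_coherent f w).symm
  rw [berezinKernel, berezinKernel, h1, h1, inner_conj_symm]
  have h2 : coherent J ħ z = U (U⁻¹ (coherent J ħ z)) := (U.apply_symm_apply _).symm
  conv_lhs => rw [h2]
  rw [U.inner_map_map]

/-- The Berezin kernel of an element of `Mp^c`, up to the scalar `(U e₀)(0)`. -/
theorem berezinKernel_eq (x : Mpc J ħ) (z v : JSpace J) :
    berezinKernel x.1.1 z v = berezinKernel x.1.1 0 0 * Complex.exp (1 / (4 * ħ) *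
      (2 * herm J ((Cg J x.1.2).symm z) v - herm J z (Zg J x.1.2⁻¹ z)
        - herm J (Zg J x.1.2 v) v)) := by
  set g := x.1.2 with hg
  set F : JSpace J → ℂ := (x.1.1 (coherent J ħ 0)).1 with hF
  have hFd : Differentiable ℂ F := (x.1.1 (coherent J ħ 0)).2.1
  -- `h` is the quotient of `U e₀` by the Gaussian it is to be a multiple of.
  let h : JSpace J → ℂ := fun z =>
    F z * Complex.exp (1 / (4 * ħ) * inner ℂ (ZgL J g⁻¹ z) z)
  have hhd : Differentiable ℂ h :=
    hFd.mul (((differentiable_inner_antilinear _).const_mul _).cexp)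
  have hFh : ∀ z, F z = h z * Complex.exp (-(1 / (4 * ħ) * inner ℂ (Zg J g⁻¹ z) z)) := by
    intro z
    simp only [h, ZgL_apply]
    rw [mul_assoc, ← Complex.exp_add, add_neg_cancel, Complex.exp_zero, mul_one]
  have hK : ∀ z v, berezinKernel x.1.1 z v = h (z - (linPart J g v + antiPart J g v)) *
      Complex.exp (1 / (4 * ħ) * (2 * inner ℂ v ((Cg J g).symm z)
        - inner ℂ (Zg J g⁻¹ z) z - inner ℂ v (Zg J g v))) := by
    intro z v
    rw [berezinKernel_covariance, kernel_exponent, ← hF, hFh, mul_left_comm, ← Complex.exp_add]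
    congr 2
    ring
  let k : JSpace J → ℂ := fun v => berezinKernel (x.1.1⁻¹ : FockSpace J ħ ≃ₗᵢ[ℂ] _) v 0 *
    Complex.exp (1 / (4 * ħ) * inner ℂ (ZgL J g v) v)
  have hkd : Differentiable ℂ k :=
    (x.1.1⁻¹ (coherent J ħ 0)).2.1.mul (((differentiable_inner_antilinear _).const_mul _).cexp)
  have hhk : ∀ v, h (-(linPart J g v + antiPart J g v)) = starRingEnd ℂ (k v) := by
    intro v
    simp only [k, map_mul, ← conj_berezinKernel, Complex.conj_conj, ← Complex.exp_conj, hK]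
    rw [mul_assoc, ← Complex.exp_add]
    simp [ZgL_apply, map_ofNat]
  have hc := eq_const_of_antiholomorphic_comp g hhd hkd hhk
  have h0 : berezinKernel x.1.1 0 0 = h 0 := by
    rw [hK]
    simp
  rw [hK, hc, h0]
  rfl

end Kernel

/-! ### Holomorphic logarithms of the determinant -/

section LogDet

variable {E : Type*} [NormedAddCommGroup E] [InnerProductSpace ℂ E]

/-- The continuous linear maps `A` with `Re ⟨A v, v⟩ > 0` for `v ≠ 0`; on `(V,Ω,j)` they form
`GL(V,j)_+`. -/
def strictlyAccretive (E : Type*) [NormedAddCommGroup E] [InnerProductSpace ℂ E] :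
    Set (E →L[ℂ] E) :=
  {A | ∀ v, v ≠ 0 → 0 < (inner ℂ v (A v)).re}

theorem one_mem_strictlyAccretive : (1 : E →L[ℂ] E) ∈ strictlyAccretive E := by
  intro v hv
  have h : (inner ℂ v v).re = ‖v‖ ^ 2 := inner_self_eq_norm_sq (𝕜 := ℂ) v
  rw [one_apply_eq_self, h]
  exact pow_pos (norm_pos_iff.2 hv) 2

theorem convex_strictlyAccretive : Convex ℝ (strictlyAccretive E) := by
  intro A hA B hB s t hs ht hst v hv
  have h1 : (inner ℂ v ((s • A + t • B) v)).re
      = s * (inner ℂ v (A v)).re + t * (inner ℂ v (B v)).re := by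
    rw [add_apply, smul_apply, smul_apply, inner_add_right, ← Complex.coe_smul,
      ← Complex.coe_smul, inner_smul_right, inner_smul_right, Complex.add_re,
      Complex.re_ofReal_mul, Complex.re_ofReal_mul]
  rw [h1]
  have hA := hA v hv
  have hB := hB v hv
  rcases hs.eq_or_lt with rfl | hs
  · have : t = 1 := by linarith
    subst this
    linarith
  · have := mul_pos hs hA
    have := mul_nonneg ht hB.le
    linarith

theorem isSimplyConnected_strictlyAccretive : IsSimplyConnected (strictlyAccretive E) := by
  have := (convex_strictlyAccretive (E := E)).contractibleSpace
    ⟨_, one_mem_strictlyAccretive (E := E)⟩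
  exact SimplyConnectedSpace.ofContractible (strictlyAccretive E)

variable [FiniteDimensional ℂ E]

theorem isOpen_strictlyAccretive : IsOpen (strictlyAccretive E) := by
  have : FiniteDimensional ℝ E := FiniteDimensional.trans ℝ ℂ E
  have : ProperSpace E := FiniteDimensional.proper ℂ E
  rw [isOpen_iff_eventually]
  intro A hA
  have h1 : ∀ v ∈ Metric.sphere (0 : E) 1,
      ∀ᶠ p : (E →L[ℂ] E) × E in nhds (A, v), 0 < (inner ℂ p.2 (p.1 p.2)).re := by
    intro v hv
    have hv0 : v ≠ 0 := by
      rintro rfl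
      simp at hv
    have hc : Continuous (fun p : (E →L[ℂ] E) × E => (inner ℂ p.2 (p.1 p.2)).re) := by
      fun_prop
    exact hc.continuousAt.eventually (lt_mem_nhds (hA v hv0))
  have h2 := (isCompact_sphere (0 : E) 1).eventually_forall_of_forall_eventually
    (P := fun (B : E →L[ℂ] E) v => 0 < (inner ℂ v (B v)).re) h1
  filter_upwards [h2] with B hB v hv
  have hv' : 0 < ‖v‖ := norm_pos_iff.2 hv
  have h3 := hB (((‖v‖⁻¹ : ℝ) : ℂ) • v) (by
    rw [mem_sphere_zero_iff_norm, norm_smul, Complex.norm_real, norm_inv, norm_norm,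
      inv_mul_cancel₀ hv'.ne'])
  rw [map_smul, inner_smul_left, inner_smul_right, Complex.conj_ofReal, Complex.re_ofReal_mul,
    Complex.re_ofReal_mul] at h3
  have h4 : 0 < ‖v‖⁻¹ := by positivity
  exact (mul_pos_iff_of_pos_left h4).1 ((mul_pos_iff_of_pos_left h4).1 h3)

theorem bijective_of_mem_strictlyAccretive {A : E →L[ℂ] E} (hA : A ∈ strictlyAccretive E) :
    Function.Bijective A := by
  have hinj : Function.Injective (A : E →ₗ[ℂ] E) := by
    rw [injective_iff_map_eq_zero]
    intro v hv
    by_contra hne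
    have h2 := hA v hne
    rw [show A v = 0 from hv, inner_zero_right, Complex.zero_re] at h2
    exact lt_irrefl _ h2
  exact ⟨hinj, LinearMap.injective_iff_surjective.1 hinj⟩

theorem differentiable_det :
    Differentiable ℂ (fun A : E →L[ℂ] E => LinearMap.det (A : E →ₗ[ℂ] E)) := by
  let b := Module.finBasis ℂ E
  simp only [← LinearMap.det_toMatrix b, Matrix.det_apply, LinearMap.toMatrix_apply]
  have h : ∀ i j, Differentiable ℂ (fun A : E →L[ℂ] E => b.repr (A (b j)) i) := by
    intro i j
    exact ((LinearMap.toContinuousLinearMap (b.coord i)).comp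
      (ContinuousLinearMap.apply ℂ E (b j))).differentiable
  refine Differentiable.fun_sum fun σ _ => Differentiable.fun_const_smul ?_ _
  exact fun A => (HasFDerivAt.finsetProd fun i _ => (h (σ i) i A).hasFDerivAt).differentiableAt

theorem det_ne_zero_of_mem_strictlyAccretive {A : E →L[ℂ] E} (hA : A ∈ strictlyAccretive E) :
    LinearMap.det (A : E →ₗ[ℂ] E) ≠ 0 :=
  (LinearEquiv.ofBijective (A : E →ₗ[ℂ] E)
    (bijective_of_mem_strictlyAccretive hA)).isUnit_det'.ne_zero

/-- `det` lifts through `exp` because `strictlyAccretive E` is convex, hence simply connected; the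
continuous lift is holomorphic because it is locally a principal logarithm. -/
theorem exists_holomorphic_log_det : ∃ a : (E →L[ℂ] E) → ℂ,
    DifferentiableOn ℂ a (strictlyAccretive E) ∧
    (∀ A ∈ strictlyAccretive E, LinearMap.det (A : E →ₗ[ℂ] E) = Complex.exp (a A)) ∧
    a 1 = 0 := by
  obtain ⟨f, hfc, hf⟩ := Complex.exists_continuousOn_eqOn_exp_comp
    isSimplyConnected_strictlyAccretive isOpen_strictlyAccretive
    (differentiable_det (E := E)).continuous.continuousOn (by
      rintro ⟨A, hA, h0⟩
      exact det_ne_zero_of_mem_strictlyAccretive hA h0)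
  replace hf : ∀ A ∈ strictlyAccretive E, Complex.exp (f A) = LinearMap.det (A : E →ₗ[ℂ] E) :=
    fun A hA => hf hA
  have hf1 : Complex.exp (f 1) = 1 := by
    rw [hf 1 one_mem_strictlyAccretive]
    exact LinearMap.det_id
  refine ⟨fun A => f A - f 1, ?_, fun A hA => ?_, sub_self _⟩
  · intro A hA
    refine DifferentiableAt.differentiableWithinAt (DifferentiableAt.sub_const ?_ _)
    -- Near `A` the branch is `f A` plus the principal logarithm of the quotient of determinants.
    have hlog : f =ᶠ[nhds A] fun B => f A + Complex.log
        (LinearMap.det (B : E →ₗ[ℂ] E) / LinearMap.det (A : E →ₗ[ℂ] E)) := by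
      have hnear := (hfc.continuousAt (isOpen_strictlyAccretive.mem_nhds hA)).eventually
        (Metric.ball_mem_nhds (f A) Real.pi_pos)
      filter_upwards [hnear, isOpen_strictlyAccretive.mem_nhds hA] with B hB hB'
      have h1 := (Complex.abs_im_le_norm (f B - f A)).trans_lt (mem_ball_iff_norm.1 hB)
      rw [abs_lt] at h1
      rw [← hf A hA, ← hf B hB', ← Complex.exp_sub, Complex.log_exp h1.1 h1.2.le]
      ring
    refine DifferentiableAt.congr_of_eventuallyEq ?_ hlog
    have hdiv : DifferentiableAt ℂ (fun B : E →L[ℂ] E => LinearMap.det (B : E →ₗ[ℂ] E)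
        / LinearMap.det (A : E →ₗ[ℂ] E)) A := by
      simp only [div_eq_mul_inv]
      exact (differentiable_det A).mul_const _
    refine (hdiv.clog ?_).const_add _
    rw [div_self (det_ne_zero_of_mem_strictlyAccretive hA)]
    exact Complex.one_mem_slitPlane
  · rw [Complex.exp_sub, hf1, div_one, hf A hA]

theorem eqOn_of_holomorphic_log_det {a b : (E →L[ℂ] E) → ℂ}
    (had : DifferentiableOn ℂ a (strictlyAccretive E))
    (ha : ∀ A ∈ strictlyAccretive E, LinearMap.det (A : E →ₗ[ℂ] E) = Complex.exp (a A))
    (hbd : DifferentiableOn ℂ b (strictlyAccretive E))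
    (hb : ∀ A ∈ strictlyAccretive E, LinearMap.det (A : E →ₗ[ℂ] E) = Complex.exp (b A))
    (h1 : b 1 = a 1) : Set.EqOn b a (strictlyAccretive E) := by
  have hd : DifferentiableOn ℂ (fun A => b A - a A) (strictlyAccretive E) := hbd.sub had
  have hexp : ∀ A ∈ strictlyAccretive E, Complex.exp (b A - a A) = 1 := by
    intro A hA
    rw [Complex.exp_sub, ← hb A hA, ← ha A hA,
      div_self (det_ne_zero_of_mem_strictlyAccretive hA)]
  have h0 : Set.EqOn (fderiv ℂ fun A => b A - a A) 0 (strictlyAccretive E) := by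
    intro A hA
    have h1 := (hd.differentiableAt (isOpen_strictlyAccretive.mem_nhds hA)).hasFDerivAt.cexp
    have h2 : (fun A => Complex.exp (b A - a A)) =ᶠ[nhds A] fun _ => 1 :=
      Filter.eventuallyEq_of_mem (isOpen_strictlyAccretive.mem_nhds hA) hexp
    have h3 := h1.unique ((hasFDerivAt_const (1 : ℂ) A).congr_of_eventuallyEq h2)
    rwa [hexp A hA, one_smul] at h3
  intro A hA
  have h2 := isOpen_strictlyAccretive.is_const_of_fderiv_eq_zero
    (convex_strictlyAccretive (E := E)).isPreconnected hd h0 hA one_mem_strictlyAccretive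
  rw [h1, sub_self] at h2
  exact sub_eq_zero.1 h2

/-- Jacobi's formula along the ray `s ↦ 1 - s N`, with `S` the inverse of `1 - t N`. -/
theorem hasDerivAt_det_one_sub_smul {N S : E →L[ℂ] E} {t : ℝ}
    (hS : ∀ z, (1 - t • N) (S z) = z) :
    HasDerivAt (fun s : ℝ => LinearMap.det ((1 - s • N : E →L[ℂ] E) : E →ₗ[ℂ] E))
      (-(LinearMap.det ((1 - t • N : E →L[ℂ] E) : E →ₗ[ℂ] E)
        * LinearMap.trace ℂ E ((S * N : E →L[ℂ] E) : E →ₗ[ℂ] E))) t := by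
  let b := Module.finBasis ℂ E
  obtain ⟨M, hM⟩ : ∃ M, M = LinearMap.toMatrix b b ((S * N : E →L[ℂ] E) : E →ₗ[ℂ] E) := ⟨_, rfl⟩
  obtain ⟨p, hp⟩ : ∃ p, p = (Matrix.det (1 + (Polynomial.X : Polynomial ℂ) •
    M.map Polynomial.C)).divX.divX := ⟨_, rfl⟩
  obtain ⟨d, hd⟩ : ∃ d, d = LinearMap.det ((1 - t • N : E →L[ℂ] E) : E →ₗ[ℂ] E) := ⟨_, rfl⟩
  have hfac : ∀ s : ℝ, LinearMap.det ((1 - s • N : E →L[ℂ] E) : E →ₗ[ℂ] E)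
      = d * (1 + M.trace * ((t - s : ℝ) : ℂ)
        + p.eval ((t - s : ℝ) : ℂ) * ((t - s : ℝ) : ℂ) ^ 2) := by
    intro s
    have h1 : ((1 - s • N : E →L[ℂ] E) : E →ₗ[ℂ] E)
        = ((1 - t • N : E →L[ℂ] E) : E →ₗ[ℂ] E) *
          (1 + ((t - s : ℝ) : ℂ) • ((S * N : E →L[ℂ] E) : E →ₗ[ℂ] E)) := by
      refine LinearMap.ext fun z => ?_
      change z - s • N z = (1 - t • N) (z + ((t - s : ℝ) : ℂ) • S (N z))
      rw [map_add, map_smul, hS, Complex.coe_smul]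
      change _ = z - t • N z + _
      module
    rw [h1, map_mul, hd, hp, ← Matrix.det_one_add_smul, hM, ← LinearMap.det_toMatrix b (1 + _),
      map_add, map_smul, LinearMap.toMatrix_one]
  have hlin : HasDerivAt (fun s : ℝ => ((t - s : ℝ) : ℂ)) (-1) t := by
    simpa using ((hasDerivAt_id t).const_sub t).ofReal_comp
  have hpd : HasDerivAt (fun s : ℝ => p.eval ((t - s : ℝ) : ℂ))
      (p.derivative.eval ((t - t : ℝ) : ℂ) * (-1)) t :=
    HasDerivAt.comp (h₂ := fun w : ℂ => p.eval w) t (p.hasDerivAt ((t - t : ℝ) : ℂ)) hlin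
  have h2 := (((hlin.const_mul M.trace).const_add 1).fun_add
    (hpd.fun_mul (hlin.fun_pow 2))).const_mul d
  simp only [hfac]
  refine h2.congr_deriv ?_
  rw [LinearMap.trace_eq_matrix_trace ℂ b, ← hM]
  simp

/-- The logarithmic form of Jacobi's formula. -/
theorem hasDerivAt_log_det {a : (E →L[ℂ] E) → ℂ}
    (had : DifferentiableOn ℂ a (strictlyAccretive E))
    (ha : ∀ A ∈ strictlyAccretive E, LinearMap.det (A : E →ₗ[ℂ] E) = Complex.exp (a A))
    {N S : E →L[ℂ] E} {t : ℝ} (ht : 1 - t • N ∈ strictlyAccretive E)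
    (hS : ∀ z, (1 - t • N) (S z) = z) :
    HasDerivAt (fun s : ℝ => a (1 - s • N))
      (-LinearMap.trace ℂ E ((S * N : E →L[ℂ] E) : E →ₗ[ℂ] E)) t := by
  have hray : HasDerivAt (fun s : ℝ => 1 - s • N) (-N) t := by
    simpa using ((hasDerivAt_id t).smul_const N).const_sub 1
  have hd : HasDerivAt (fun s : ℝ => a (1 - s • N)) _ t := ((had.differentiableAt
    (isOpen_strictlyAccretive.mem_nhds ht)).hasFDerivAt.restrictScalars ℝ).comp_hasDerivAt t hray
  have hev : (fun s : ℝ => Complex.exp (a (1 - s • N))) =ᶠ[nhds t] fun s : ℝ =>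
      LinearMap.det ((1 - s • N : E →L[ℂ] E) : E →ₗ[ℂ] E) := by
    filter_upwards [hray.continuousAt.eventually (isOpen_strictlyAccretive.mem_nhds ht)] with s hs
    exact (ha _ hs).symm
  have h1 := hd.cexp.unique ((hasDerivAt_det_one_sub_smul hS).congr_of_eventuallyEq hev)
  refine hd.congr_deriv ?_
  rw [← ha _ ht, ← mul_neg] at h1
  exact mul_left_cancel₀ (det_ne_zero_of_mem_strictlyAccretive ht) h1

variable {V : Type*} [AddCommGroup V] [Module ℝ V] [FiniteDimensional ℝ V] {Ω : SymplecticForm V}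

/-- Invertibility is automatic in the definition of `GL(V,j)_+`, since the numerical range avoids
`0`. -/
theorem GLplus_eq (J : PCCS Ω) : GLplus J = strictlyAccretive (JSpace J) := by
  ext A
  have h : ∀ v, (herm J ((A + ContinuousLinearMap.adjoint A) v) v).re
      = 2 * (inner ℂ v (A v)).re := by
    intro v
    rw [← inner_eq_herm, add_apply, inner_add_right,
      ContinuousLinearMap.adjoint_inner_right, ← inner_conj_symm (A v) v, Complex.add_re,
      Complex.conj_re]
    ring
  simp only [GLplus, Set.mem_ofPred_eq, h]
  constructor
  · rintro ⟨-, h1⟩ v hv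
    linarith [h1 v hv]
  · intro h1
    exact ⟨ContinuousLinearMap.isUnit_iff_bijective.2 (bijective_of_mem_strictlyAccretive h1),
      fun v hv => by linarith [h1 v hv]⟩

end LogDet

/-! ### Gaussian integrands -/

section GaussianIntegral

variable {V : Type*} [AddCommGroup V] [Module ℝ V] {Ω : SymplecticForm V} {J : PCCS Ω}

/-- The exponent `2|z|² + t⟨z, A z⟩_j + ⟨B z, z⟩_j`. -/
def gaussExponent (A B : JSpace J →L⋆[ℂ] JSpace J) (t : ℝ) (z : JSpace J) : ℂ :=
  2 * inner ℂ z z + t * inner ℂ (A z) z + inner ℂ z (B z)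

/-- The Gaussian `exp(-(2|z|² + t⟨z, A z⟩_j + ⟨B z, z⟩_j)/4ħ)`. -/
def gauss (ħ : ℝ) (A B : JSpace J →L⋆[ℂ] JSpace J) (t : ℝ) (z : JSpace J) : ℂ :=
  Complex.exp (-(1 / (4 * ħ)) * gaussExponent A B t z)

variable {A B : JSpace J →L⋆[ℂ] JSpace J} {ħ k t : ℝ}

theorem norm_gauss_le (hħ : 0 < ħ) (hAk : ∀ z, ‖A z‖ ≤ k * ‖z‖) (hBk : ∀ z, ‖B z‖ ≤ k * ‖z‖)
    (z : JSpace J) :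
    ‖gauss ħ A B t z‖ ≤ Real.exp (-((2 - |t| * k - k) / (4 * ħ)) * ‖z‖ ^ 2) := by
  have h1 : (inner ℂ z z).re = ‖z‖ ^ 2 := inner_self_eq_norm_sq (𝕜 := ℂ) z
  have h2 : -(k * ‖z‖ ^ 2) ≤ (inner ℂ z (B z)).re := by
    have := (abs_le.1 ((Complex.abs_re_le_norm _).trans (norm_inner_le_norm (𝕜 := ℂ) z (B z)))).1
    nlinarith [hBk z, norm_nonneg z]
  have h3 : -(|t| * (k * ‖z‖ ^ 2)) ≤ t * (inner ℂ (A z) z).re := by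
    have h4 : |(inner ℂ (A z) z).re| ≤ k * ‖z‖ ^ 2 := by
      refine ((Complex.abs_re_le_norm _).trans (norm_inner_le_norm (𝕜 := ℂ) (A z) z)).trans ?_
      nlinarith [hAk z, norm_nonneg z]
    have h5 := neg_abs_le (t * (inner ℂ (A z) z).re)
    rw [abs_mul] at h5
    nlinarith [abs_nonneg t]
  rw [gauss, Complex.norm_exp, Real.exp_le_exp]
  have h6 : (-(1 / (4 * (ħ : ℂ))) * gaussExponent A B t z).re
      = -(1 / (4 * ħ)) * (gaussExponent A B t z).re := by
    rw [← Complex.re_ofReal_mul]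
    push_cast
    rfl
  have h7 : (gaussExponent A B t z).re
      = 2 * ‖z‖ ^ 2 + t * (inner ℂ (A z) z).re + (inner ℂ z (B z)).re := by
    rw [gaussExponent, Complex.add_re, Complex.add_re, Complex.re_ofReal_mul, ← h1]
    simp
  rw [h6, h7]
  have h8 : 0 < 1 / (4 * ħ) := by positivity
  have h9 : -((2 - |t| * k - k) / (4 * ħ)) * ‖z‖ ^ 2
      = -(1 / (4 * ħ)) * ((2 - |t| * k - k) * ‖z‖ ^ 2) := by ring
  rw [h9]
  nlinarith

theorem continuous_gauss : Continuous (gauss ħ A B t) := by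
  unfold gauss gaussExponent
  fun_prop

theorem hasLineDerivAt_gauss (hA : ∀ x y, inner ℂ (A x) y = inner ℂ (A y) x)
    (hB : ∀ x y, inner ℂ (B x) y = inner ℂ (B y) x) (z u : JSpace J) :
    HasLineDerivAt ℝ (gauss ħ A B t) (-(1 / (2 * ħ)) * (inner ℂ z u + inner ℂ u z
      + t * inner ℂ (A z) u + inner ℂ u (B z)) * gauss ħ A B t z) z u := by
  have hB' : inner ℂ z (B u) = inner ℂ u (B z) := by
    rw [← inner_conj_symm, hB, inner_conj_symm]
  have hq : ∀ s : ℝ, gaussExponent A B t (z + s • u) = gaussExponent A B t z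
      + (s : ℂ) * (2 * (inner ℂ z u + inner ℂ u z + t * inner ℂ (A z) u + inner ℂ u (B z)))
      + (s : ℂ) ^ 2 * gaussExponent A B t u := by
    intro s
    simp only [gaussExponent, map_add, ← Complex.coe_smul, map_smulₛₗ,
      inner_add_left, inner_add_right, inner_smul_left, inner_smul_right, Complex.conj_ofReal,
      hA u z, hB']
    ring
  have hs : HasDerivAt (fun s : ℝ => (s : ℂ)) 1 0 := Complex.ofRealCLM.hasDerivAt
  have h1 := ((((hs.mul_const (2 * (inner ℂ z u + inner ℂ u z + t * inner ℂ (A z) u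
    + inner ℂ u (B z)))).const_add (gaussExponent A B t z)).fun_add
      ((hs.fun_pow 2).mul_const (gaussExponent A B t u))).const_mul (-(1 / (4 * ħ) : ℂ))).cexp
  simp only [← hq] at h1
  refine HasDerivAt.congr_deriv h1 ?_
  simp only [gauss, zero_smul, add_zero, Complex.ofReal_zero]
  ring

variable [FiniteDimensional ℝ V]

theorem integrable_one_add_norm_sq_mul_exp (J : PCCS Ω) {δ : ℝ} (hδ : 0 < δ) :
    Integrable (fun z : JSpace J => (1 + ‖z‖ ^ 2) * Real.exp (-δ * ‖z‖ ^ 2)) := by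
  have h1 : Integrable (fun z : JSpace J => Real.exp (-(δ / 2) * ‖z‖ ^ 2)) := by
    have := fockWeight_integrable J (ħ := 1 / δ) (by positivity)
    refine this.congr (Filter.Eventually.of_forall fun z => ?_)
    simp only [fockWeight]
    congr 1
    field_simp
  refine (h1.const_mul (1 + 2 / δ)).mono' (by fun_prop) (Filter.Eventually.of_forall fun z => ?_)
  rw [Real.norm_of_nonneg (by positivity)]
  have h2 : Real.exp (-δ * ‖z‖ ^ 2)
      = Real.exp (-(δ / 2) * ‖z‖ ^ 2) * Real.exp (-(δ / 2) * ‖z‖ ^ 2) := by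
    rw [← Real.exp_add]
    congr 1
    ring
  have h3 : (1 + ‖z‖ ^ 2) * Real.exp (-(δ / 2) * ‖z‖ ^ 2) ≤ 1 + 2 / δ := by
    have h4 : Real.exp (-(δ / 2) * ‖z‖ ^ 2) ≤ 1 := by
      rw [Real.exp_le_one_iff]
      nlinarith [sq_nonneg ‖z‖]
    have h5 : ‖z‖ ^ 2 * Real.exp (-(δ / 2) * ‖z‖ ^ 2) ≤ 2 / δ := by
      rw [neg_mul, Real.exp_neg, ← div_eq_mul_inv, div_le_iff₀ (Real.exp_pos _)]
      have h6 := Real.add_one_le_exp (δ / 2 * ‖z‖ ^ 2)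
      calc ‖z‖ ^ 2 = 2 / δ * (δ / 2 * ‖z‖ ^ 2) := by field_simp
        _ ≤ _ := by gcongr; linarith
    linarith
  rw [h2, ← mul_assoc]
  exact mul_le_mul_of_nonneg_right h3 (Real.exp_pos _).le

theorem integrable_mul_gauss (hħ : 0 < ħ) (hAk : ∀ z, ‖A z‖ ≤ k * ‖z‖)
    (hBk : ∀ z, ‖B z‖ ≤ k * ‖z‖) (hk : |t| * k + k < 2) {p : JSpace J → ℂ} (hp : Continuous p)
    {M : ℝ} (hM : ∀ z, ‖p z‖ ≤ M * (1 + ‖z‖ ^ 2)) :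
    Integrable (fun z => p z * gauss ħ A B t z) := by
  have hδ : 0 < (2 - |t| * k - k) / (4 * ħ) := div_pos (by linarith) (by positivity)
  refine ((integrable_one_add_norm_sq_mul_exp J hδ).const_mul M).mono'
    (hp.mul continuous_gauss).aestronglyMeasurable (Filter.Eventually.of_forall fun z => ?_)
  rw [norm_mul, ← mul_assoc]
  exact mul_le_mul (hM z) (norm_gauss_le hħ hAk hBk z) (norm_nonneg _)
    ((norm_nonneg _).trans (hM z))

theorem integrable_inner_mul_gauss (hħ : 0 < ħ) (hAk : ∀ z, ‖A z‖ ≤ k * ‖z‖)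
    (hBk : ∀ z, ‖B z‖ ≤ k * ‖z‖) (hk : |t| * k + k < 2) (w : JSpace J) :
    Integrable (fun z => inner ℂ w z * gauss ħ A B t z) := by
  refine integrable_mul_gauss hħ hAk hBk hk (by fun_prop) (M := ‖w‖) fun z => ?_
  have := norm_inner_le_norm (𝕜 := ℂ) w z
  nlinarith [norm_nonneg w, norm_nonneg z, sq_nonneg (‖z‖ - 1)]

theorem integrable_inner_mul_mul_gauss (hħ : 0 < ħ) (hAk : ∀ z, ‖A z‖ ≤ k * ‖z‖)
    (hBk : ∀ z, ‖B z‖ ≤ k * ‖z‖) (hk : |t| * k + k < 2) (w : JSpace J) {l : JSpace J → ℂ}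
    (hl : Continuous l) {M : ℝ} (hM : ∀ z, ‖l z‖ ≤ M * ‖z‖) :
    Integrable (fun z => inner ℂ w z * l z * gauss ħ A B t z) := by
  refine integrable_mul_gauss hħ hAk hBk hk (by fun_prop) (M := ‖w‖ * |M|) fun z => ?_
  rw [norm_mul]
  calc ‖inner ℂ w z‖ * ‖l z‖ ≤ (‖w‖ * ‖z‖) * (|M| * ‖z‖) := by
        refine mul_le_mul (norm_inner_le_norm (𝕜 := ℂ) w z) ((hM z).trans ?_) (norm_nonneg _)
          (by positivity)
        gcongr
        exact le_abs_self M
    _ = ‖w‖ * |M| * ‖z‖ ^ 2 := by ring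
    _ ≤ ‖w‖ * |M| * (1 + ‖z‖ ^ 2) := by gcongr; linarith

end GaussianIntegral

/-! ### Gaussian integrals -/

section GaussianODE

variable {V : Type*} [AddCommGroup V] [Module ℝ V] {Ω : SymplecticForm V} {J : PCCS Ω}
  {A B : JSpace J →L⋆[ℂ] JSpace J} {ħ k t : ℝ}

theorem one_sub_smul_comp_mem (hk1 : k < 1) (ht : |t| ≤ 1)
    (hAk : ∀ z, ‖A z‖ ≤ k * ‖z‖) (hBk : ∀ z, ‖B z‖ ≤ k * ‖z‖) :
    (1 - t • B.comp A : JSpace J →L[ℂ] JSpace J) ∈ strictlyAccretive (JSpace J) := by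
  intro v hv
  have hv' : 0 < ‖v‖ := norm_pos_iff.2 hv
  have h1 : (inner ℂ v v).re = ‖v‖ ^ 2 := inner_self_eq_norm_sq (𝕜 := ℂ) v
  have h2 : inner ℂ v ((1 - t • B.comp A : JSpace J →L[ℂ] JSpace J) v)
      = inner ℂ v v - t * inner ℂ v (B (A v)) := by
    change inner ℂ v (v - t • B (A v)) = _
    rw [inner_sub_right, ← Complex.coe_smul, inner_smul_right]
  have h3 : |(inner ℂ v (B (A v))).re| ≤ k * ‖v‖ ^ 2 := by
    have h4 : ‖B (A v)‖ ≤ k * ‖v‖ := by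
      nlinarith [hBk (A v), hAk v, norm_nonneg (A v)]
    refine ((Complex.abs_re_le_norm _).trans (norm_inner_le_norm (𝕜 := ℂ) v _)).trans ?_
    nlinarith
  have h5 : t * (inner ℂ v (B (A v))).re ≤ 1 * (k * ‖v‖ ^ 2) := by
    refine (le_abs_self _).trans ?_
    rw [abs_mul]
    exact mul_le_mul ht h3 (abs_nonneg _) zero_le_one
  rw [h2, Complex.sub_re, Complex.re_ofReal_mul, h1]
  nlinarith [pow_pos hv' 2]

variable [FiniteDimensional ℝ V]

/-- Integration by parts against a real direction `u`. -/
theorem integral_inner_mul_gauss (hħ : 0 < ħ) (hAk : ∀ z, ‖A z‖ ≤ k * ‖z‖)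
    (hBk : ∀ z, ‖B z‖ ≤ k * ‖z‖) (hk : |t| * k + k < 2)
    (hA : ∀ x y, inner ℂ (A x) y = inner ℂ (A y) x)
    (hB : ∀ x y, inner ℂ (B x) y = inner ℂ (B y) x) (w u : JSpace J) :
    (∫ z, inner ℂ w z * (inner ℂ z u + t * inner ℂ (A z) u) * gauss ħ A B t z)
      + (∫ z, inner ℂ w z * (inner ℂ u z + inner ℂ u (B z)) * gauss ħ A B t z)
      = 2 * ħ * inner ℂ w u * ∫ z, gauss ħ A B t z := by
  have hb1 : ∀ z, ‖inner ℂ z u + t * inner ℂ (A z) u‖ ≤ (‖u‖ + |t| * (k * ‖u‖)) * ‖z‖ := by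
    intro z
    refine (norm_add_le _ _).trans ?_
    rw [norm_mul, Complex.norm_real, Real.norm_eq_abs]
    have h1 := norm_inner_le_norm (𝕜 := ℂ) z u
    have h2 : ‖inner ℂ (A z) u‖ ≤ k * ‖u‖ * ‖z‖ :=
      (norm_inner_le_norm (𝕜 := ℂ) (A z) u).trans (by nlinarith [hAk z, norm_nonneg u])
    nlinarith [mul_le_mul_of_nonneg_left h2 (abs_nonneg t)]
  have hb2 : ∀ z, ‖inner ℂ u z + inner ℂ u (B z)‖ ≤ (‖u‖ + ‖u‖ * k) * ‖z‖ := by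
    intro z
    refine (norm_add_le _ _).trans ?_
    have h1 := norm_inner_le_norm (𝕜 := ℂ) u z
    have h2 := norm_inner_le_norm (𝕜 := ℂ) u (B z)
    nlinarith [mul_le_mul_of_nonneg_left (hBk z) (norm_nonneg u)]
  have hi1 := integrable_inner_mul_mul_gauss (l := fun z => inner ℂ z u + t * inner ℂ (A z) u)
    hħ hAk hBk hk w (by fun_prop) hb1
  have hi2 := integrable_inner_mul_mul_gauss (l := fun z => inner ℂ u z + inner ℂ u (B z))
    hħ hAk hBk hk w (by fun_prop) hb2
  have hi0 : Integrable (gauss ħ A B t) := by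
    simpa using integrable_mul_gauss hħ hAk hBk hk (p := fun _ => 1) continuous_const (M := 1)
      fun z => by simp
  have h0 : (ħ : ℂ) ≠ 0 := by exact_mod_cast hħ.ne'
  have hfg : (fun z => inner ℂ w z * (-(1 / (2 * ħ)) * (inner ℂ z u + inner ℂ u z
      + t * inner ℂ (A z) u + inner ℂ u (B z)) * gauss ħ A B t z))
      = fun z => -(1 / (2 * ħ) : ℂ) * (inner ℂ w z * (inner ℂ z u + t * inner ℂ (A z) u)
        * gauss ħ A B t z + inner ℂ w z * (inner ℂ u z + inner ℂ u (B z)) * gauss ħ A B t z) := by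
    funext z
    ring
  have key := integral_bilinear_hasLineDerivAt_right_eq_neg_left_of_integrable
    (μ := (volume : Measure (JSpace J)))
    (f := fun z => inner ℂ w z) (f' := fun _ => inner ℂ w u) (g := gauss ħ A B t)
    (g' := fun z => -(1 / (2 * ħ)) * (inner ℂ z u + inner ℂ u z
      + t * inner ℂ (A z) u + inner ℂ u (B z)) * gauss ħ A B t z) (v := u)
    (B := ContinuousLinearMap.mul ℝ ℂ) (hi0.const_mul _)
    (by
      simp only [ContinuousLinearMap.mul_apply']
      rw [hfg]
      exact (hi1.add hi2).const_mul _)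
    (integrable_inner_mul_gauss hħ hAk hBk hk w)
    (fun z _ => by
      have := ((innerSL ℂ w).hasFDerivAt (x := z)).restrictScalars ℝ
      exact this.hasLineDerivAt u)
    (fun z _ => hasLineDerivAt_gauss hA hB z u)
  simp only [ContinuousLinearMap.mul_apply'] at key
  rw [hfg, integral_const_mul, integral_const_mul, integral_add hi1 hi2] at key
  field_simp at key
  linear_combination -key

/-- The holomorphic and antiholomorphic parts of the integration by parts, obtained by comparing
the directions `u` and `i u`. -/
theorem integral_inner_mul_gauss_split (hħ : 0 < ħ) (hAk : ∀ z, ‖A z‖ ≤ k * ‖z‖)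
    (hBk : ∀ z, ‖B z‖ ≤ k * ‖z‖) (hk : |t| * k + k < 2)
    (hA : ∀ x y, inner ℂ (A x) y = inner ℂ (A y) x)
    (hB : ∀ x y, inner ℂ (B x) y = inner ℂ (B y) x) (w u : JSpace J) :
    (∫ z, inner ℂ w z * (inner ℂ z u + t * inner ℂ (A z) u) * gauss ħ A B t z)
        = 2 * ħ * inner ℂ w u * ∫ z, gauss ħ A B t z ∧
      (∫ z, inner ℂ w z * (inner ℂ u z + inner ℂ u (B z)) * gauss ħ A B t z) = 0 := by
  have h1 := integral_inner_mul_gauss hħ hAk hBk hk hA hB w u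
  have h2 := integral_inner_mul_gauss hħ hAk hBk hk hA hB w (Complex.I • u)
  have e1 : ∀ z, inner ℂ w z * (inner ℂ z (Complex.I • u) + t * inner ℂ (A z) (Complex.I • u))
      * gauss ħ A B t z = Complex.I *
        (inner ℂ w z * (inner ℂ z u + t * inner ℂ (A z) u) * gauss ħ A B t z) := by
    intro z
    simp only [inner_smul_right]
    ring
  have e2 : ∀ z, inner ℂ w z * (inner ℂ (Complex.I • u) z + inner ℂ (Complex.I • u) (B z))
      * gauss ħ A B t z = -Complex.I *
        (inner ℂ w z * (inner ℂ u z + inner ℂ u (B z)) * gauss ħ A B t z) := by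
    intro z
    simp only [inner_smul_left, Complex.conj_I]
    ring
  have e3 : inner ℂ w (Complex.I • u) = Complex.I * inner ℂ w u := inner_smul_right _ _ _
  simp only [e1, e2, e3, integral_const_mul] at h2
  generalize (∫ z, inner ℂ w z * (inner ℂ z u + t * inner ℂ (A z) u) * gauss ħ A B t z) = P at *
  generalize (∫ z, inner ℂ w z * (inner ℂ u z + inner ℂ u (B z)) * gauss ħ A B t z) = Q at *
  generalize (∫ z, gauss ħ A B t z) = R at *
  constructor
  · linear_combination h1 / 2 - Complex.I / 2 * h2
      + (P - Q - 2 * ħ * inner ℂ w u * R) / 2 * Complex.I_sq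
  · linear_combination h1 / 2 + Complex.I / 2 * h2
      - (P - Q - 2 * ħ * inner ℂ w u * R) / 2 * Complex.I_sq

/-- The second moments of the Gaussian, with `S` the inverse of `1 - t B A`. -/
theorem integral_inner_mul_inner_mul_gauss (hħ : 0 < ħ) (hAk : ∀ z, ‖A z‖ ≤ k * ‖z‖)
    (hBk : ∀ z, ‖B z‖ ≤ k * ‖z‖) (hk : |t| * k + k < 2)
    (hA : ∀ x y, inner ℂ (A x) y = inner ℂ (A y) x)
    (hB : ∀ x y, inner ℂ (B x) y = inner ℂ (B y) x) {S : JSpace J →L[ℂ] JSpace J}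
    (hS : ∀ z, S z - t • B (A (S z)) = z) (w u : JSpace J) :
    ∫ z, inner ℂ w z * inner ℂ (A z) u * gauss ħ A B t z
      = -(2 * ħ * inner ℂ w (S (B (A u))) * ∫ z, gauss ħ A B t z) := by
  have hk1 : ∀ u z : JSpace J, ‖inner ℂ z u‖ ≤ ‖u‖ * ‖z‖ := fun u z =>
    (norm_inner_le_norm (𝕜 := ℂ) z u).trans_eq (mul_comm _ _)
  have hk2 : ∀ u z : JSpace J, ‖inner ℂ (A z) u‖ ≤ k * ‖u‖ * ‖z‖ := fun u z =>
    (norm_inner_le_norm (𝕜 := ℂ) (A z) u).trans (by nlinarith [hAk z, norm_nonneg u])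
  have hiY : ∀ u, Integrable (fun z => inner ℂ w z * inner ℂ z u * gauss ħ A B t z) := fun u =>
    integrable_inner_mul_mul_gauss hħ hAk hBk hk w (continuous_id.inner continuous_const) (hk1 u)
  have hiX : ∀ u, Integrable (fun z => inner ℂ w z * inner ℂ (A z) u * gauss ħ A B t z) := fun u =>
    integrable_inner_mul_mul_gauss hħ hAk hBk hk w (by fun_prop) (hk2 u)
  have hXY : ∀ u, ∫ z, inner ℂ w z * inner ℂ (A z) u * gauss ħ A B t z
      = -∫ z, inner ℂ w z * inner ℂ z (B (A u)) * gauss ħ A B t z := by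
    intro u
    have h1 := (integral_inner_mul_gauss_split hħ hAk hBk hk hA hB w (A u)).2
    have h2 : ∀ z, inner ℂ (A u) (B z) = inner ℂ z (B (A u)) := by
      intro z
      rw [← inner_conj_symm, hB, inner_conj_symm]
    have h3 : ∀ z, inner ℂ w z * (inner ℂ (A u) z + inner ℂ (A u) (B z)) * gauss ħ A B t z
        = inner ℂ w z * inner ℂ (A z) u * gauss ħ A B t z
          + inner ℂ w z * inner ℂ z (B (A u)) * gauss ħ A B t z := by
      intro z
      rw [h2, hA u z]
      ring
    simp only [h3] at h1
    rw [integral_add (hiX u) (hiY _)] at h1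
    exact eq_neg_of_add_eq_zero_left h1
  have hY : ∀ u, ∫ z, inner ℂ w z * inner ℂ z (u - t • B (A u)) * gauss ħ A B t z
      = 2 * ħ * inner ℂ w u * ∫ z, gauss ħ A B t z := by
    intro u
    rw [← (integral_inner_mul_gauss_split hħ hAk hBk hk hA hB w u).1]
    have h3 : ∀ z, inner ℂ w z * (inner ℂ z u + t * inner ℂ (A z) u) * gauss ħ A B t z
        = inner ℂ w z * inner ℂ z u * gauss ħ A B t z
          + t * (inner ℂ w z * inner ℂ (A z) u * gauss ħ A B t z) := by
      intro z
      ring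
    have h4 : ∀ z, inner ℂ w z * inner ℂ z (u - t • B (A u)) * gauss ħ A B t z
        = inner ℂ w z * inner ℂ z u * gauss ħ A B t z
          - t * (inner ℂ w z * inner ℂ z (B (A u)) * gauss ħ A B t z) := by
      intro z
      rw [inner_sub_right, ← Complex.coe_smul, inner_smul_right]
      ring
    simp only [h3, h4]
    rw [integral_add (hiY u) ((hiX u).const_mul _), integral_sub (hiY u) ((hiY _).const_mul _),
      integral_const_mul, integral_const_mul, hXY]
    ring
  rw [hXY, ← hY, hS]

/-- The differential equation of the Gaussian integral in `t`. -/
theorem hasDerivAt_integral_gauss (hħ : 0 < ħ) (hk0 : 0 ≤ k) (hk1 : k < 1) (ht : |t| ≤ 1)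
    (hAk : ∀ z, ‖A z‖ ≤ k * ‖z‖) (hBk : ∀ z, ‖B z‖ ≤ k * ‖z‖)
    (hA : ∀ x y, inner ℂ (A x) y = inner ℂ (A y) x)
    (hB : ∀ x y, inner ℂ (B x) y = inner ℂ (B y) x) {S : JSpace J →L[ℂ] JSpace J}
    (hS : ∀ z, S z - t • B (A (S z)) = z) :
    HasDerivAt (fun s : ℝ => ∫ z, gauss ħ A B s z)
      (1 / 2 * LinearMap.trace ℂ (JSpace J) ((S * B.comp A : JSpace J →L[ℂ] JSpace J) :
        JSpace J →ₗ[ℂ] JSpace J) * ∫ z, gauss ħ A B t z) t := by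
  have h0 : (ħ : ℂ) ≠ 0 := by exact_mod_cast hħ.ne'
  have hk : |t| * k + k < 2 := by nlinarith
  -- On this ball the decay rate `2 - |s| k - k` is at least
  -- `2 - (2 - k) k - k = (1 - k)(2 - k) > 0`.
  have hbound : ∀ s ∈ Metric.ball t (1 - k), |s| ≤ 2 - k := by
    intro s hs
    rw [Metric.mem_ball, Real.dist_eq] at hs
    have := abs_sub_abs_le_abs_sub s t
    linarith
  have hδ : 0 < (2 - (2 - k) * k - k) / (4 * ħ) := div_pos (by nlinarith) (by positivity)
  have hi0 : Integrable (gauss ħ A B t) := by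
    simpa using integrable_mul_gauss hħ hAk hBk hk (p := fun _ => 1) continuous_const (M := 1)
      fun z => by simp
  have hder := (hasDerivAt_integral_of_dominated_loc_of_deriv_le
    (μ := (volume : Measure (JSpace J))) (F := fun (s : ℝ) z => gauss ħ A B s z)
    (F' := fun (s : ℝ) z => -(1 / (4 * ħ)) * inner ℂ (A z) z * gauss ħ A B s z)
    (bound := fun z => k / (4 * ħ) * ((1 + ‖z‖ ^ 2)
      * Real.exp (-((2 - (2 - k) * k - k) / (4 * ħ)) * ‖z‖ ^ 2)))
    (Metric.ball_mem_nhds t (by linarith : 0 < 1 - k))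
    (Filter.Eventually.of_forall fun s => continuous_gauss.aestronglyMeasurable) hi0
    (by
      have := continuous_gauss (ħ := ħ) (A := A) (B := B) (t := t)
      exact Continuous.aestronglyMeasurable (by fun_prop))
    (Filter.Eventually.of_forall fun z s hs => by
      have h1 : ‖inner ℂ (A z) z‖ ≤ k * (1 + ‖z‖ ^ 2) :=
        (norm_inner_le_norm (𝕜 := ℂ) (A z) z).trans (by nlinarith [hAk z, norm_nonneg z])
      have h2 : ‖(-(1 / (4 * ħ)) : ℂ)‖ = 1 / (4 * ħ) := by
        rw [norm_neg, norm_div, norm_mul, Complex.norm_real, Real.norm_of_nonneg hħ.le]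
        simp
      have h3 : ‖gauss ħ A B s z‖
          ≤ Real.exp (-((2 - (2 - k) * k - k) / (4 * ħ)) * ‖z‖ ^ 2) := by
        refine (norm_gauss_le hħ hAk hBk z).trans (Real.exp_le_exp.2 ?_)
        have h4 := mul_le_mul_of_nonneg_right (hbound s hs) hk0
        gcongr
      rw [norm_mul, norm_mul, h2]
      calc 1 / (4 * ħ) * ‖inner ℂ (A z) z‖ * ‖gauss ħ A B s z‖
          ≤ 1 / (4 * ħ) * (k * (1 + ‖z‖ ^ 2))
            * Real.exp (-((2 - (2 - k) * k - k) / (4 * ħ)) * ‖z‖ ^ 2) := by gcongr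
        _ = _ := by ring)
    ((integrable_one_add_norm_sq_mul_exp J hδ).const_mul _)
    (Filter.Eventually.of_forall fun z s _ => by
      have hs : HasDerivAt (fun s : ℝ => (s : ℂ)) 1 s := Complex.ofRealCLM.hasDerivAt
      have h1 := ((((hs.mul_const (inner ℂ (A z) z)).const_add (2 * inner ℂ z z)).add_const
        (inner ℂ z (B z))).const_mul (-(1 / (4 * ħ) : ℂ))).cexp
      refine HasDerivAt.congr_deriv h1 ?_
      rw [gauss, gaussExponent]
      ring)).2
  refine hder.congr_deriv ?_
  let e := stdOrthonormalBasis ℂ (JSpace J)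
  -- Expanding `⟨z, A z⟩` in an orthonormal basis turns its mean into a trace of second moments.
  have hsum : ∀ z, -(1 / (4 * ħ) : ℂ) * inner ℂ (A z) z * gauss ħ A B t z
      = -(1 / (4 * ħ) : ℂ) * ∑ i, inner ℂ (e i) z * inner ℂ (A z) (e i) * gauss ħ A B t z := by
    intro z
    rw [← Finset.sum_mul, ← e.sum_inner_mul_inner (A z) z, mul_assoc]
    simp only [mul_comm]
  have hi : ∀ u, Integrable (fun z => inner ℂ u z * inner ℂ (A z) u * gauss ħ A B t z) := fun u =>
    integrable_inner_mul_mul_gauss (M := k * ‖u‖) hħ hAk hBk hk u (by fun_prop) fun z =>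
      (norm_inner_le_norm (𝕜 := ℂ) (A z) u).trans (by nlinarith [hAk z, norm_nonneg u])
  simp only [hsum]
  rw [integral_const_mul, integral_finsetSum _ fun i _ => hi (e i)]
  simp only [integral_inner_mul_inner_mul_gauss hħ hAk hBk hk hA hB hS]
  rw [LinearMap.trace_eq_sum_inner _ e, Finset.sum_neg_distrib, ← Finset.sum_mul,
    ← Finset.mul_sum]
  change _ = 1 / 2 * (∑ i, inner ℂ (e i) (S (B (A (e i))))) * _
  field_simp
  ring

/-- The Gaussian integral, with the square root of the determinant given by a holomorphic
logarithm. The product of the integral with `exp (a(1 - t B A)/2)` is constant in `t`, and its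
value at `t = 0` follows from the mean value property. -/
theorem integral_gauss (hħ : 0 < ħ) (hk0 : 0 ≤ k) (hk1 : k < 1)
    (hAk : ∀ z, ‖A z‖ ≤ k * ‖z‖) (hBk : ∀ z, ‖B z‖ ≤ k * ‖z‖)
    (hA : ∀ x y, inner ℂ (A x) y = inner ℂ (A y) x)
    (hB : ∀ x y, inner ℂ (B x) y = inner ℂ (B y) x) {a : (JSpace J →L[ℂ] JSpace J) → ℂ}
    (ha : IsLogDet J a) :
    ∫ z, gauss ħ A B 1 z = (2 * Real.pi * ħ) ^ Module.finrank ℂ (JSpace J)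
      * Complex.exp (-(1 / 2) * a (1 - B.comp A)) := by
  have had := ha.holomorphic
  have hexp := ha.exp_eq
  rw [GLplus_eq] at had hexp
  have hmem : ∀ t ∈ Set.Icc (0 : ℝ) 1,
      (1 - t • B.comp A : JSpace J →L[ℂ] JSpace J) ∈ strictlyAccretive (JSpace J) := fun t ht =>
    one_sub_smul_comp_mem hk1 (abs_le.2 ⟨by linarith [ht.1], ht.2⟩) hAk hBk
  let Φ : ℝ → ℂ := fun t => (∫ z, gauss ħ A B t z)
    * Complex.exp (1 / 2 * a (1 - t • B.comp A))
  have hΦ : ∀ t ∈ Set.Icc (0 : ℝ) 1, HasDerivAt Φ 0 t := by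
    intro t ht
    have hb := bijective_of_mem_strictlyAccretive (hmem t ht)
    let S : JSpace J →L[ℂ] JSpace J := LinearMap.toContinuousLinearMap
      ((LinearEquiv.ofBijective ((1 - t • B.comp A : JSpace J →L[ℂ] JSpace J) :
        JSpace J →ₗ[ℂ] JSpace J) hb).symm : JSpace J →ₗ[ℂ] JSpace J)
    have hS : ∀ z, (1 - t • B.comp A : JSpace J →L[ℂ] JSpace J) (S z) = z := fun z =>
      LinearEquiv.apply_symm_apply (LinearEquiv.ofBijective
        ((1 - t • B.comp A : JSpace J →L[ℂ] JSpace J) : JSpace J →ₗ[ℂ] JSpace J) hb) z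
    have h1 := hasDerivAt_integral_gauss hħ hk0 hk1 (abs_le.2 ⟨by linarith [ht.1], ht.2⟩)
      hAk hBk hA hB (S := S) hS
    have h2 := ((hasDerivAt_log_det had hexp (hmem t ht) hS).const_mul (1 / 2)).cexp
    refine (h1.fun_mul h2).congr_deriv ?_
    ring
  have hconst := constant_of_has_deriv_right_zero (f := Φ) (a := 0) (b := 1)
    (fun t ht => (hΦ t ht).continuousAt.continuousWithinAt)
    (fun t ht => (hΦ t (Set.Ico_subset_Icc_self ht)).hasDerivWithinAt) 1
    (Set.right_mem_Icc.2 zero_le_one)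
  have h0 : ∫ z, gauss ħ A B 0 z = (2 * Real.pi * ħ) ^ Module.finrank ℂ (JSpace J) := by
    let h : JSpace J → ℂ := fun z => Complex.exp (-(1 / (4 * ħ)) * inner ℂ (B z) z)
    have hh : Differentiable ℂ h := ((differentiable_inner_antilinear B).const_mul _).cexp
    have hconj : ∀ z, gauss ħ A B 0 z
        = starRingEnd ℂ (h z * (fockWeight J ħ z : ℂ)) := by
      intro z
      simp only [h]
      rw [gauss, gaussExponent, fockWeight, Complex.ofReal_exp, ← Complex.exp_add,
        ← Complex.exp_conj]
      congr 1
      push_cast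
      rw [norm_sq_eq_inner]
      simp only [map_add, map_mul, map_neg, map_div₀, map_ofNat, map_one, Complex.conj_ofReal,
        inner_conj_symm]
      field_simp
      ring
    have hi : Integrable (fun z => h z * (fockWeight J ħ z : ℂ)) := by
      have h1 : Integrable (gauss ħ A B 0) := by
        simpa using integrable_mul_gauss (t := 0) hħ hAk hBk (by simp; linarith)
          (p := fun _ => 1) continuous_const (M := 1) fun z => by simp
      have h2 := Complex.conjCLE.toContinuousLinearMap.integrable_comp h1
      refine h2.congr (Filter.Eventually.of_forall fun z => ?_)
      change starRingEnd ℂ (gauss ħ A B 0 z) = _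
      rw [hconj, Complex.conj_conj]
    simp only [hconj]
    rw [integral_conj, integral_mul_fockWeight hh hi, integral_complex_ofReal,
      integral_fockWeight J hħ]
    simp [h, map_ofNat]
  have hz : (1 - (0 : ℝ) • B.comp A : JSpace J →L[ℂ] JSpace J) = 1 := by
    refine ContinuousLinearMap.ext fun z => ?_
    change z - (0 : ℝ) • B (A z) = z
    rw [zero_smul, sub_zero]
  simp only [Φ, h0, hz, one_smul, ha.one_eq, mul_zero, Complex.exp_zero, mul_one] at hconst
  rw [← hconst, mul_assoc, ← Complex.exp_add]
  simp

end GaussianODE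

/-! ### Parameters and composition -/

section Composition

variable {V : Type*} [AddCommGroup V] [Module ℝ V] [FiniteDimensional ℝ V] {Ω : SymplecticForm V}
  {J : PCCS Ω}

theorem oneSubZZ_eq (g₁ g₂ : Sp Ω) :
    oneSubZZ J g₁ g₂ = 1 - (ZgL J g₁).comp (ZgL J g₂⁻¹) := rfl

theorem exists_common_bound (g₁ g₂ : Sp Ω) : ∃ k : ℝ, 0 ≤ k ∧ k < 1 ∧
    (∀ z, ‖ZgL J g₁ z‖ ≤ k * ‖z‖) ∧ ∀ z, ‖ZgL J g₂ z‖ ≤ k * ‖z‖ := by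
  obtain ⟨k₁, h₁, h₁', hk₁⟩ := exists_norm_Zg_le J g₁
  obtain ⟨k₂, -, h₂', hk₂⟩ := exists_norm_Zg_le J g₂
  exact ⟨max k₁ k₂, h₁.trans (le_max_left _ _), max_lt h₁' h₂',
    fun z => (hk₁ z).trans (by gcongr; exact le_max_left _ _),
    fun z => (hk₂ z).trans (by gcongr; exact le_max_right _ _)⟩

theorem oneSubZZ_mem_GLplus (g₁ g₂ : Sp Ω) : oneSubZZ J g₁ g₂ ∈ GLplus J := by
  obtain ⟨k, -, hk1, hA, hB⟩ := exists_common_bound (J := J) g₂⁻¹ g₁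
  have h := one_sub_smul_comp_mem (t := 1) hk1 (by simp) hA hB
  rw [one_smul] at h
  rwa [GLplus_eq, oneSubZZ_eq]

theorem norm_det_Cg_inv (g : Sp Ω) :
    ‖LinearMap.det (Cg J g⁻¹ : JSpace J →ₗ[ℂ] JSpace J)‖
      = ‖LinearMap.det (Cg J g : JSpace J →ₗ[ℂ] JSpace J)‖ := by
  let e := stdOrthonormalBasis ℂ (JSpace J)
  have h1 : (Cg J g : JSpace J →ₗ[ℂ] JSpace J)
      = LinearMap.adjoint (Cg J g⁻¹ : JSpace J →ₗ[ℂ] JSpace J) := by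
    rw [LinearMap.eq_adjoint_iff]
    exact inner_linPart J g
  rw [h1, ← LinearMap.det_toMatrix e.toBasis (LinearMap.adjoint _), LinearMap.toMatrix_adjoint,
    Matrix.det_conjTranspose, norm_star, LinearMap.det_toMatrix]

/-- `1 - Z_{g⁻¹}²` has determinant of modulus `|det C_g|⁻²`. -/
theorem norm_det_oneSubZZ_inv (g : Sp Ω) :
    ‖LinearMap.det (oneSubZZ J g⁻¹ g : JSpace J →ₗ[ℂ] JSpace J)‖
      * ‖LinearMap.det (Cg J g : JSpace J →ₗ[ℂ] JSpace J)‖ ^ 2 = 1 := by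
  have h1 : (oneSubZZ J g⁻¹ g : JSpace J →ₗ[ℂ] JSpace J)
      = ((Cg J g⁻¹).symm : JSpace J →ₗ[ℂ] JSpace J) ∘ₗ ((Cg J g).symm : JSpace J →ₗ[ℂ] JSpace J) :=
    LinearMap.ext fun z => sub_Zg_inv_Zg_inv J g z
  have h2 := congrArg norm (LinearEquiv.det_symm_mul_det (Cg J g⁻¹))
  have h3 := congrArg norm (LinearEquiv.det_symm_mul_det (Cg J g))
  rw [norm_mul, norm_one] at h2 h3
  rw [norm_det_Cg_inv] at h2
  rw [h1, LinearMap.det_comp, norm_mul]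
  linear_combination (‖LinearMap.det ((Cg J g).symm : JSpace J →ₗ[ℂ] JSpace J)‖
    * ‖LinearMap.det (Cg J g : JSpace J →ₗ[ℂ] JSpace J)‖) * h2 + h3

variable {ħ : ℝ} [hħ : Fact (0 < ħ)]

/-- The vacuum expectation of a product, computed as a Gaussian integral. -/
theorem berezinKernel_mul_zero {a : (JSpace J →L[ℂ] JSpace J) → ℂ} (ha : IsLogDet J a)
    (x₁ x₂ : Mpc J ħ) :
    berezinKernel (x₁ * x₂).1.1 0 0 = berezinKernel x₁.1.1 0 0 * berezinKernel x₂.1.1 0 0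
      * Complex.exp (-(1 / 2) * a (oneSubZZ J x₁.1.2 x₂.1.2)) := by
  have h0 := hħ.out
  have hne : (((2 * Real.pi * ħ) ^ Module.finrank ℂ (JSpace J) : ℝ) : ℂ) ≠ 0 := by
    exact_mod_cast (by positivity : (2 * Real.pi * ħ) ^ Module.finrank ℂ (JSpace J) ≠ 0)
  have h1 : berezinKernel (x₁ * x₂).1.1 0 0 = FockSpace.pairing (x₂.1.1 (coherent J ħ 0))
      (x₁.1.1⁻¹ (coherent J ħ 0)) := by
    change x₁.1.1 (x₂.1.1 (coherent J ħ 0)) 0 = inner ℂ (x₁.1.1⁻¹ (coherent J ħ 0)) _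
    have h2 : coherent J ħ 0 = x₁.1.1 (x₁.1.1⁻¹ (coherent J ħ 0)) :=
      (x₁.1.1.apply_symm_apply _).symm
    rw [← x₁.1.1.inner_map_map, ← h2]
    exact (FockSpace.pairing_coherent _ 0).symm
  have h3 : ∀ z, starRingEnd ℂ ((x₁.1.1⁻¹ (coherent J ħ 0)) z) * x₂.1.1 (coherent J ħ 0) z
      * (fockWeight J ħ z : ℂ) = berezinKernel x₁.1.1 0 0 * berezinKernel x₂.1.1 0 0
        * gauss ħ (ZgL J x₂.1.2⁻¹) (ZgL J x₁.1.2) 1 z := by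
    intro z
    have h4 : starRingEnd ℂ ((x₁.1.1⁻¹ (coherent J ħ 0)) z) = berezinKernel x₁.1.1 0 z := by
      have := conj_berezinKernel x₁.1.1 0 z
      rw [← Complex.conj_conj (berezinKernel x₁.1.1 0 z), this]
      rfl
    have h5 : x₂.1.1 (coherent J ħ 0) z = berezinKernel x₂.1.1 z 0 := rfl
    rw [h4, h5, berezinKernel_eq x₁ 0 z, berezinKernel_eq x₂ z 0, fockWeight, Complex.ofReal_exp,
      gauss, gaussExponent]
    have h6 : ∀ p q r s t : ℂ, p * Complex.exp q * (r * Complex.exp s) * Complex.exp t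
        = p * r * Complex.exp (q + s + t) := by
      intro p q r s t
      rw [Complex.exp_add, Complex.exp_add]
      ring
    rw [h6]
    congr 2
    push_cast
    rw [norm_sq_eq_inner]
    simp only [← inner_eq_herm, map_zero, inner_zero_left, inner_zero_right, ZgL_apply]
    field_simp
    ring
  obtain ⟨k, hk0, hk1, hA, hB⟩ := exists_common_bound (J := J) x₂.1.2⁻¹ x₁.1.2
  rw [h1, FockSpace.pairing]
  simp only [h3]
  rw [integral_const_mul, integral_gauss h0 hk0 hk1 hA hB (inner_Zg J _) (inner_Zg J _) ha,
    ← oneSubZZ_eq]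
  push_cast at hne ⊢
  field_simp

/-- The normalisation of `λ` expresses `(U⁻¹ U e₀)(0) = 1`: the Gaussian integral is then
`‖U e₀‖²` up to `|λ|²`, and equals `|det C_g|` in modulus. -/
theorem norm_sq_mul_det_eq_one {a : (JSpace J →L[ℂ] JSpace J) → ℂ} (ha : IsLogDet J a)
    (x : Mpc J ħ) : ‖berezinKernel x.1.1 0 0 ^ 2
      * LinearMap.det (Cg J x.1.2 : JSpace J →ₗ[ℂ] JSpace J)‖ = 1 := by
  have h1 := berezinKernel_mul_zero ha x⁻¹ x
  have h2 : berezinKernel (x⁻¹ * x).1.1 0 0 = 1 := by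
    rw [inv_mul_cancel]
    exact coherent_zero_apply 0
  have h3 : berezinKernel (x⁻¹).1.1 0 0 = starRingEnd ℂ (berezinKernel x.1.1 0 0) :=
    (conj_berezinKernel x.1.1 0 0).symm
  have h4 : oneSubZZ J (x⁻¹).1.2 x.1.2 = oneSubZZ J x.1.2⁻¹ x.1.2 := rfl
  rw [h2, h3, h4] at h1
  have h5 := congrArg norm h1
  rw [norm_one, norm_mul, norm_mul, RCLike.norm_conj] at h5
  have h6 := norm_det_oneSubZZ_inv (J := J) x.1.2
  rw [ha.exp_eq _ (oneSubZZ_mem_GLplus _ _)] at h6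
  set c := a (oneSubZZ J x.1.2⁻¹ x.1.2)
  set d := ‖LinearMap.det (Cg J x.1.2 : JSpace J →ₗ[ℂ] JSpace J)‖
  set m := ‖berezinKernel x.1.1 0 0‖
  set E := ‖Complex.exp (-(1 / 2) * c)‖
  have h7 : ‖Complex.exp c‖ * E ^ 2 = 1 := by
    rw [← norm_pow, ← norm_mul, ← Complex.exp_nat_mul, ← Complex.exp_add]
    have : c + ((2 : ℕ) : ℂ) * (-(1 / 2) * c) = 0 := by push_cast; ring
    rw [this, Complex.exp_zero, norm_one]
  have h8 : ‖Complex.exp c‖ ≠ 0 := by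
    intro h
    rw [h, zero_mul] at h7
    exact zero_ne_one h7
  have h9 : E = d := by
    rw [← pow_left_inj₀ (norm_nonneg _) (norm_nonneg _) two_ne_zero]
    exact mul_left_cancel₀ h8 (h7.trans h6.symm)
  rw [norm_mul, norm_pow]
  change m ^ 2 * d = 1
  rw [← h9]
  linear_combination -h5

/-- Every element of `Mp^c` has parameters, with `λ` its vacuum expectation. -/
theorem hasParameters_berezinKernel {a : (JSpace J →L[ℂ] JSpace J) → ℂ} (ha : IsLogDet J a)
    (x : Mpc J ħ) : HasParameters x x.1.2 (berezinKernel x.1.1 0 0) where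
  sp_eq := rfl
  norm_eq := norm_sq_mul_det_eq_one ha x
  kernel_eq := berezinKernel_eq x

theorem HasParameters.eq_berezinKernel {x : Mpc J ħ} {g : Sp Ω} {c : ℂ}
    (h : HasParameters x g c) : c = berezinKernel x.1.1 0 0 := by
  rw [h.kernel_eq]
  simp [← inner_eq_herm]

end Composition

end

end SymplecticMpc

theorem mainTheorem5 {V : Type*} [AddCommGroup V] [Module ℝ V] [FiniteDimensional ℝ V]
    {Ω : SymplecticMpc.SymplecticForm V} (J : SymplecticMpc.PCCS Ω) (ħ : ℝ) [Fact (0 < ħ)] :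
    ∃ a : (SymplecticMpc.JSpace J →L[ℂ] SymplecticMpc.JSpace J) → ℂ,
      SymplecticMpc.IsLogDet J a ∧
      (∀ b, SymplecticMpc.IsLogDet J b → Set.EqOn b a (SymplecticMpc.GLplus J)) ∧
      (∀ x : SymplecticMpc.Mpc J ħ,
        ∃! p : SymplecticMpc.Sp Ω × ℂ, SymplecticMpc.HasParameters x p.1 p.2) ∧
      ∀ (x₁ x₂ : SymplecticMpc.Mpc J ħ) (g₁ g₂ : SymplecticMpc.Sp Ω) (l₁ l₂ : ℂ),
        SymplecticMpc.HasParameters x₁ g₁ l₁ → SymplecticMpc.HasParameters x₂ g₂ l₂ →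
        SymplecticMpc.oneSubZZ J g₁ g₂ ∈ SymplecticMpc.GLplus J ∧
        SymplecticMpc.HasParameters (x₁ * x₂) (g₁ * g₂)
          (l₁ * l₂ * Complex.exp (-(1 / 2) * a (SymplecticMpc.oneSubZZ J g₁ g₂))) := by
  obtain ⟨a, had, haexp, ha1⟩ :=
    SymplecticMpc.exists_holomorphic_log_det (E := SymplecticMpc.JSpace J)
  rw [← SymplecticMpc.GLplus_eq] at had haexp
  have ha : SymplecticMpc.IsLogDet J a := ⟨had, haexp, ha1⟩
  refine ⟨a, ha, fun b hb => ?_, fun x => ?_, ?_⟩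
  · have hbd := hb.holomorphic
    have hbexp := hb.exp_eq
    rw [SymplecticMpc.GLplus_eq] at had haexp hbd hbexp ⊢
    exact SymplecticMpc.eqOn_of_holomorphic_log_det had haexp hbd hbexp (hb.one_eq.trans ha1.symm)
  · refine ⟨(_, _), SymplecticMpc.hasParameters_berezinKernel ha x, ?_⟩
    rintro ⟨g, c⟩ h
    exact Prod.ext h.sp_eq.symm h.eq_berezinKernel
  · rintro x₁ x₂ g₁ g₂ l₁ l₂ h₁ h₂
    obtain rfl := h₁.sp_eq
    obtain rfl := h₂.sp_eq
    obtain rfl := h₁.eq_berezinKernel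
    obtain rfl := h₂.eq_berezinKernel
    refine ⟨SymplecticMpc.oneSubZZ_mem_GLplus _ _, ?_⟩
    rw [← SymplecticMpc.berezinKernel_mul_zero ha]
    exact SymplecticMpc.hasParameters_berezinKernel ha (x₁ * x₂)
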